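/- **Notation.** Let $\theta_1,\theta_2,\theta_3,\theta_\infty\in\mathbb C$ with $\theta_\infty\neq 0,\ \pm(\theta_1+\theta_2+\theta_3)$, and put $\Theta=\mathrm{diag}(\theta_1,\theta_2,\theta_3)$, $\mu_1=\tfrac12(\theta_\infty-\theta_1-\theta_2-\theta_3)$, $\mu_3=\tfrac12(-\theta_\infty-\theta_1-\theta_2-\theta_3)$; so $0,\mu_1,\mu_3$ are distinct. PVI is $$y''=\tfrac12\Bigl[\tfrac1y+\tfrac1{y-1}+\tfrac1{y-x}\Bigr](y')^2-\Bigl[\tfrac1x+\tfrac1{x-1}+\tfrac1{y-x}\Bigr]y'+\tfrac{y(y-1)(y-x)}{x^2(x-1)^2}\Bigl[\alpha+\beta\tfrac{x}{y^2}+\gamma\tfrac{x-1}{(y-1)^2}+\delta\tfrac{x(x-1)}{(y-x)^2}\Bigr]$$ with $2\alpha=(\theta_\infty-1)^2$, $2\beta=-\theta_1^2$, $2\gamma=\theta_3^2$, $2\delta=1-\theta_2^2$. A *transcendent* on an open set $D\subset\mathbb C\setminus\{0,1\}$ is a holomorphic solution $y$ of PVI on $D$ with $y(x)\notin\{0,1,x\}$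 for all $x\in D$. Let $\Delta=\bigcup_{i\ne j}\{u\in\mathbb C^3: u_i=u_j\}$, $U=\mathrm{diag}(u_1,u_2,u_3)$, let $E_k$ be the matrix with $1$ in position $(k,k)$ and $0$ elsewhere, $x(u)=\frac{u_2-u_1}{u_3-u_1}$, and for a $3\times3$ matrix function $V(u)$ put $$V_k=\Bigl(\frac{V_{ij}(\delta_{ik}-\delta_{jk})}{u_i-u_j}\Bigr)_{i,j=1}^3\ (\text{zero diagonal}),\qquad \omega=\Bigl(U+\frac Vz\Bigr)dz+\sum_{k=1}^3(zE_k+V_k)\,du_k .$$ A matrix is *constrained* if its diagonal is $-\Theta$ and its eigenvalues are $0,\mu_1,\mu_3$. A constrained matrix $A$ is *nondegenerate at $u$* if, for a left eigenvector $\ell$ of eigenvalue $\mu_1$ and a right eigenvector $r$ of eigenvalue $\mu_3$, $\ell_kr_k\neq0$ for $k=1,2,3$ and $\sum_k u_k\ell_kr_k\ne0$. The reduced system, for a matrix function $\Omega(x)$, is $$\frac{d\Omega}{dx}=[\Omega,\widehat\Omega_2],\qquad \widehat\Omega_2=\frac1{1-x}\begin{pmatrix}0&0&0\\0&0&\Omega_{23}\\0&\Omega_{32}&0\end{pmatrix}-\frac1x\begin{pmatrix}0&\Omega_{12}&0\\\Omega_{21}&0&0\\0&0&0\end{pmatrix},$$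 and a solution $\Omega$ is called nondegenerate at $x$ if $\Omega(x)$ is nondegenerate at $(0,x,1)$. For given $y,k_1,k_2$ the *explicit formulae* are $\mathrm{diag}\,\Omega=-\Theta$ and, with $y'=dy/dx$, $$\Omega_{12}=\tfrac{k_1}{k_2}\,\tfrac{(x^2-x)y'+(\theta_\infty-1)y^2+(\theta_2-\theta_1+1-(\theta_\infty+\theta_2)x)y+\theta_1x}{2(x-1)y},\quad \Omega_{21}=\tfrac{k_2}{k_1}\,\tfrac{(x^2-x)y'+(\theta_\infty-1)y^2+(\theta_1-\theta_2+1-(\theta_\infty-\theta_2)x)y-\theta_1x}{2(x-y)},$$ $$\Omega_{13}=k_1\,\tfrac{(x-x^2)y'+(1-\theta_\infty)y^2+((\theta_1-\theta_3)x+\theta_\infty+\theta_3-1)y-\theta_1x}{2(x-1)y},\quad \Omega_{31}=\tfrac1{k_1}\,\tfrac{(x-x^2)y'+(1-\theta_\infty)y^2+((\theta_3-\theta_1)x+\theta_\infty-\theta_3-1)y+\theta_1x}{2x(y-1)},$$ $$\Omega_{23}=k_2\,\tfrac{(x-x^2)y'+(1-\theta_\infty)y^2+((\theta_\infty-\theta_2)x+\theta_\infty+\theta_3-1)y-x(\theta_\infty-\theta_2+\theta_3)}{2(x-y)},$$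 $$\Omega_{32}=\tfrac1{k_2}\,\tfrac{(x-x^2)y'+(1-\theta_\infty)y^2+((\theta_\infty+\theta_2)x+\theta_\infty-\theta_3-1)y-x(\theta_\infty+\theta_2-\theta_3)}{2x(1-y)},$$ where $k_1,k_2$ are nowhere zero with $k_j'=l_jk_j$, $$l_1=\frac{x(1-x)y'+(\theta_2-\theta_1-\theta_3+1)y^2+((\theta_1+\theta_3)x+\theta_1-\theta_2-1)y-\theta_1x}{2x(x-1)(y-1)y},$$ $$l_2=\frac{1}{2x(1-x)(1-y)(x-y)}\Bigl(-x(x-1)^2y'+\bigl((\theta_1-3\theta_2+\theta_3+1)x-\theta_1+\theta_2+\theta_3-1\bigr)y^2+\bigl((2\theta_2-\theta_1-\theta_3)x^2+(3\theta_2-3\theta_3-1)x+\theta_1-\theta_2+1\bigr)y+\bigl((\theta_1-2\theta_2+2\theta_3)x-\theta_1\bigr)x\Bigr).$$ **Theorem.** 1. Let $\mathbb D\subset\mathbb C^3\setminus\Delta$ be open and $V$ holomorphic on $\mathbb D$. The Pfaffian system $dY=\omega Y$ is Frobenius integrable ($d\omega=\omega\wedge\omega$ for $z\ne0$, $u\in\mathbb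 D$) if and only if $\partial_kV=[V_k,V]$ for $k=1,2,3$. 2. Let $\mathbb D\subset\mathbb C^3\setminus\Delta$ be open, with connected (or empty) sets $\{u\in\mathbb D: x(u)=c\}$, $c\in\mathbb C$, and with a holomorphic branch of $\log(u_3-u_1)$ (for instance, any polydisc disjoint from $\Delta$). A matrix function $V$ on $\mathbb D$ is a holomorphic constrained solution of $\partial_kV=[V_k,V]$, $k=1,2,3$, if and only if $V=(u_3-u_1)^{\Theta}\,\Omega(x(u))\,(u_3-u_1)^{-\Theta}$ on $\mathbb D$ with a constrained solution $\Omega$ of the reduced system on $x(\mathbb D)$. Moreover, $V$ is such a solution and nondegenerate at every point of $\mathbb D$ if and only if this holds with $\Omega$ given by the explicit formulae for some transcendent $y$ on $x(\mathbb D)$ and some $k_1,k_2$ as above. 3. Let $D\subset\mathbb C\setminus\{0,1\}$ be open. A matrix function $\Omega$ on $D$ is a constrained solution of the reduced system that is nondegenerate at every point of $D$ if and only if it is given by the explicit formulae for some transcendent $y$ on $D$ and some $k_1,k_2$ as above. 4. Let $D\subset\mathbb C\setminus\{0,1\}$ be open and connected and $\Omega$ a constrained solution of the reduced system on $D$ that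 is nondegenerate at some point of $D$. Then the set $D'\subset D$ of points at which $\Omega$ is nondegenerate is open, its complement in $D$ is discrete and closed in $D$, and there are a meromorphic function $y$ on $D$ that is a transcendent on $D'$, and $k_1,k_2$ as above on $D'$, such that $\Omega$ is given by the explicit formulae on $D'$. 5. Let $D\subset\mathbb C\setminus\{0,1\}$ be open and connected, and such that every holomorphic function on $D$ has a primitive (e.g. $D$ simply connected). There is a bijection between transcendents $y$ on $D$ and equivalence classes $\{K^0\Omega(K^0)^{-1}:\ K^0=\mathrm{diag}(k_1^0,k_2^0,1),\ k_1^0,k_2^0\in\mathbb C\setminus\{0\}\}$ of constrained solutions of the reduced system that are nondegenerate at every point of $D$. The class of $\Omega$ corresponds to $y$ if and only if $\Omega$ is given by the explicit formulae with quadratures $k_j(x)=k_j^0\exp L_j(x)$, $L_j'=l_j$, $k_j^0\in\mathbb C\setminus\{0\}$, $j=1,2$. 6. Let $\mathbb D\subset\mathbb C^3\setminus\Delta$ be open and convex (e.g. a polydisc), with a holomorphic branch of $\log(u_3-u_1)$ fixed on it. There is a bijection between transcendents $y$ on $x(\mathbb D)$ and equivalence classes $\{K^0V(K^0)^{-1}:\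 K^0=\mathrm{diag}(k_1^0,k_2^0,1),\ k_1^0,k_2^0\in\mathbb C\setminus\{0\}\}$ of holomorphic constrained solutions $V$ of $\partial_kV=[V_k,V]$, $k=1,2,3$, on $\mathbb D$ that are nondegenerate at every point of $\mathbb D$. The class of $V$ corresponds to $y$ if and only if $V=(u_3-u_1)^{\Theta}\Omega(x(u))(u_3-u_1)^{-\Theta}$ with $\Omega$ given by the explicit formulae and quadratures as in 5. -/

import Mathlib

open Complex Polynomial

namespace PainleveSix

/-- Complex `3 × 3` matrices; the indices `1, 2, 3` are `0, 1, 2 : Fin 3`. -/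
abbrev Mat3 := Matrix (Fin 3) (Fin 3) ℂ

/-! ### The sixth Painlevé equation -/

/-- The right-hand side of PVI, `y'' = pviRhs α β γ δ x y y'`. -/
noncomputable def pviRhs (α β γ δ x y p : ℂ) : ℂ :=
  (1 / 2) * (1 / y + 1 / (y - 1) + 1 / (y - x)) * p ^ 2
    - (1 / x + 1 / (x - 1) + 1 / (y - x)) * p
    + y * (y - 1) * (y - x) / (x ^ 2 * (x - 1) ^ 2) *
      (α + β * x / y ^ 2 + γ * (x - 1) / (y - 1) ^ 2 + δ * (x * (x - 1)) / (y - x) ^ 2)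

/-- `y` is holomorphic on `D`, avoids the values `0`, `1`, `x` at which the equation is singular,
and solves PVI with `2α = (θ∞ - 1)²`, `2β = -θ₁²`, `2γ = θ₃²`, `2δ = 1 - θ₂²`. -/
def IsTranscendent (θ : Fin 3 → ℂ) (θinf : ℂ) (D : Set ℂ) (y : ℂ → ℂ) : Prop :=
  DifferentiableOn ℂ y D ∧
  ∀ x ∈ D, y x ≠ 0 ∧ y x ≠ 1 ∧ y x ≠ x ∧
    deriv (deriv y) x =
      pviRhs ((θinf - 1) ^ 2 / 2) (-(θ 0) ^ 2 / 2) ((θ 2) ^ 2 / 2) ((1 - (θ 1) ^ 2) / 2)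
        x (y x) (deriv y x)

/-! ### The Pfaffian system and its integrability -/

/-- A matrix valued 1-form `ω = ∑ₐ ωₐ dpₐ` in `n` complex variables satisfies `dω = ω ∧ ω`
on `W`, i.e. `∂ₐ ω_b - ∂_b ωₐ = [ωₐ, ω_b]` for all `a, b`. -/
def FrobeniusIntegrable {n : ℕ} (ω : Fin n → (Fin n → ℂ) → Mat3) (W : Set (Fin n → ℂ)) : Prop :=
  ∀ p ∈ W, ∀ a b : Fin n, ∀ i j : Fin 3,
    fderiv ℂ (fun q => ω b q i j) p (Pi.single a 1)
        - fderiv ℂ (fun q => ω a q i j) p (Pi.single b 1)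
      = (ω a p * ω b p - ω b p * ω a p) i j

/-- The union of the diagonals `u_i = u_j`, `i ≠ j`. -/
def coalescenceLocus : Set (Fin 3 → ℂ) := {u | ∃ i j, i ≠ j ∧ u i = u j}

/-- `V_k = (V_ij (δ_ik - δ_jk) / (u_i - u_j))`, with zero diagonal. -/
noncomputable def Vk (k : Fin 3) (u : Fin 3 → ℂ) (A : Mat3) : Mat3 :=
  Matrix.of fun i j =>
    if i = j then 0
    else A i j * ((if i = k then 1 else 0) - (if j = k then 1 else 0)) / (u i - u j)

/-- The coefficients of `ω = (U + V / z) dz + ∑ₖ (z Eₖ + Vₖ) duₖ`. The four variables are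
`p = (z, u₁, u₂, u₃)`. -/
noncomputable def pfaffianForm (V : (Fin 3 → ℂ) → Mat3) : Fin 4 → (Fin 4 → ℂ) → Mat3 :=
  Fin.cons
    (fun p => Matrix.diagonal (Fin.tail p) + (p 0)⁻¹ • V (Fin.tail p))
    (fun k p => p 0 • Matrix.single k k (1 : ℂ) + Vk k (Fin.tail p) (V (Fin.tail p)))

/-- `V` is holomorphic on `𝔻`. -/
def HolomorphicOn (𝔻 : Set (Fin 3 → ℂ)) (V : (Fin 3 → ℂ) → Mat3) : Prop :=
  ∀ i j, DifferentiableOn ℂ (fun u => V u i j) 𝔻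

/-- The equations `∂ₖ V = [Vₖ, V]`, `k = 1, 2, 3`. -/
def DeformationEq (𝔻 : Set (Fin 3 → ℂ)) (V : (Fin 3 → ℂ) → Mat3) : Prop :=
  ∀ u ∈ 𝔻, ∀ k i j : Fin 3,
    fderiv ℂ (fun w => V w i j) u (Pi.single k 1)
      = (Vk k u (V u) * V u - V u * Vk k u (V u)) i j

/-! ### The constraints -/

/-- `(θ∞ - θ₁ - θ₂ - θ₃) / 2`. -/
noncomputable def mu1 (θ : Fin 3 → ℂ) (θinf : ℂ) : ℂ := (θinf - ∑ i, θ i) / 2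

/-- `(-θ∞ - θ₁ - θ₂ - θ₃) / 2`. -/
noncomputable def mu3 (θ : Fin 3 → ℂ) (θinf : ℂ) : ℂ := (-θinf - ∑ i, θ i) / 2

/-- The diagonal is `-Θ` and the eigenvalues are `0, μ₁, μ₃`. -/
def Constrained (θ : Fin 3 → ℂ) (θinf : ℂ) (A : Mat3) : Prop :=
  (∀ i, A i i = -θ i) ∧
  A.charpoly = X * (X - C (mu1 θ θinf)) * (X - C (mu3 θ θinf))

/-- Nondegeneracy at `u`: for a left eigenvector `ℓ` of eigenvalue `μ₁` and a right eigenvector `r`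
of eigenvalue `μ₃`, the rational function `∑ₖ ℓₖ rₖ / (λ - uₖ)` of `λ` has poles at all three
points `uₖ` and one finite zero (recall `∑ₖ ℓₖ rₖ = 0`). -/
def Nondegenerate (θ : Fin 3 → ℂ) (θinf : ℂ) (u : Fin 3 → ℂ) (A : Mat3) : Prop :=
  ∃ l r : Fin 3 → ℂ,
    Matrix.vecMul l A = mu1 θ θinf • l ∧ Matrix.mulVec A r = mu3 θ θinf • r ∧
    (∀ k, l k * r k ≠ 0) ∧ ∑ k, u k * (l k * r k) ≠ 0

/-- Holomorphic solutions `V` of the deformation equations, subject to the constraints. -/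
def IsVSolution (θ : Fin 3 → ℂ) (θinf : ℂ) (𝔻 : Set (Fin 3 → ℂ))
    (V : (Fin 3 → ℂ) → Mat3) : Prop :=
  HolomorphicOn 𝔻 V ∧ DeformationEq 𝔻 V ∧ ∀ u ∈ 𝔻, Constrained θ θinf (V u)

/-! ### The reduced system -/

/-- The matrix `Ω̂₂` of the reduced system. -/
noncomputable def omegaHat (x : ℂ) (A : Mat3) : Mat3 :=
  (1 / (1 - x)) • !![0, 0, 0; 0, 0, A 1 2; 0, A 2 1, 0]
    - (1 / x) • !![0, A 0 1, 0; A 1 0, 0, 0; 0, 0, 0]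

/-- Solutions of `dΩ/dx = [Ω, Ω̂₂]` on `D`, subject to the constraints. -/
def IsOmegaSolution (θ : Fin 3 → ℂ) (θinf : ℂ) (D : Set ℂ) (Ω : ℂ → Mat3) : Prop :=
  (∀ x ∈ D, ∀ i j, HasDerivAt (fun t => Ω t i j)
    ((Ω x * omegaHat x (Ω x) - omegaHat x (Ω x) * Ω x) i j) x) ∧
  ∀ x ∈ D, Constrained θ θinf (Ω x)

/-- `x = (u₂ - u₁) / (u₃ - u₁)`. -/
noncomputable def xOf (u : Fin 3 → ℂ) : ℂ := (u 1 - u 0) / (u 2 - u 0)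

/-- `s^Θ A s^(-Θ)`, where `L` is the chosen value of `log s`. -/
noncomputable def powConj (θ : Fin 3 → ℂ) (L : ℂ) (A : Mat3) : Mat3 :=
  Matrix.diagonal (fun i => exp (θ i * L)) * A * Matrix.diagonal (fun i => exp (-(θ i * L)))

/-- `L` is a holomorphic branch of `log (u₃ - u₁)` on `𝔻`. -/
def IsLogBranch (𝔻 : Set (Fin 3 → ℂ)) (L : (Fin 3 → ℂ) → ℂ) : Prop :=
  DifferentiableOn ℂ L 𝔻 ∧ ∀ u ∈ 𝔻, exp (L u) = u 2 - u 0

/-! ### The explicit formulae -/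

/-- The matrix `Ω` in terms of `x`, `y`, `p = dy/dx`, `k₁`, `k₂`. -/
noncomputable def explicitOmega (θ : Fin 3 → ℂ) (θinf x y p k1 k2 : ℂ) : Mat3 :=
  !![-θ 0,
     k1 / k2 * (((x ^ 2 - x) * p + (θinf - 1) * y ^ 2
        + (θ 1 - θ 0 + 1 - (θinf + θ 1) * x) * y + θ 0 * x) / (2 * (x - 1) * y)),
     k1 * (((x - x ^ 2) * p + (1 - θinf) * y ^ 2
        + ((θ 0 - θ 2) * x + θinf + θ 2 - 1) * y - θ 0 * x) / (2 * (x - 1) * y));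
     k2 / k1 * (((x ^ 2 - x) * p + (θinf - 1) * y ^ 2
        + (θ 0 - θ 1 + 1 - (θinf - θ 1) * x) * y - θ 0 * x) / (2 * (x - y))),
     -θ 1,
     k2 * (((x - x ^ 2) * p + (1 - θinf) * y ^ 2
        + ((θinf - θ 1) * x + θinf + θ 2 - 1) * y - x * (θinf - θ 1 + θ 2)) / (2 * (x - y)));
     1 / k1 * (((x - x ^ 2) * p + (1 - θinf) * y ^ 2
        + ((θ 2 - θ 0) * x + θinf - θ 2 - 1) * y + θ 0 * x) / (2 * x * (y - 1))),
     1 / k2 * (((x - x ^ 2) * p + (1 - θinf) * y ^ 2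
        + ((θinf + θ 1) * x + θinf - θ 2 - 1) * y - x * (θinf + θ 1 - θ 2)) / (2 * x * (1 - y))),
     -θ 2]

/-- The function `l₁`, with `p = dy/dx`. -/
noncomputable def l1 (θ : Fin 3 → ℂ) (x y p : ℂ) : ℂ :=
  (x * (1 - x) * p + (θ 1 - θ 0 - θ 2 + 1) * y ^ 2
    + ((θ 0 + θ 2) * x + θ 0 - θ 1 - 1) * y - θ 0 * x) / (2 * x * (x - 1) * (y - 1) * y)

/-- The function `l₂`, with `p = dy/dx`. -/
noncomputable def l2 (θ : Fin 3 → ℂ) (x y p : ℂ) : ℂ :=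
  1 / (2 * x * (1 - x) * (1 - y) * (x - y)) *
    (-x * (x - 1) ^ 2 * p
      + ((θ 0 - 3 * θ 1 + θ 2 + 1) * x - θ 0 + θ 1 + θ 2 - 1) * y ^ 2
      + ((2 * θ 1 - θ 0 - θ 2) * x ^ 2 + (3 * θ 1 - 3 * θ 2 - 1) * x + θ 0 - θ 1 + 1) * y
      + ((θ 0 - 2 * θ 1 + 2 * θ 2) * x - θ 0) * x)

/-- `k₁`, `k₂` are nowhere zero on `D` with `dkⱼ/dx = lⱼ kⱼ`. -/
def SolvesQuadratures (θ : Fin 3 → ℂ) (D : Set ℂ) (y k1 k2 : ℂ → ℂ) : Prop :=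
  ∀ x ∈ D, k1 x ≠ 0 ∧ k2 x ≠ 0 ∧
    HasDerivAt k1 (l1 θ x (y x) (deriv y x) * k1 x) x ∧
    HasDerivAt k2 (l2 θ x (y x) (deriv y x) * k2 x) x

/-- `kⱼ = kⱼ⁰ exp Lⱼ` on `D`, where `kⱼ⁰ ≠ 0` is a constant and `Lⱼ` is a primitive of `lⱼ`. -/
def GivenByQuadratures (θ : Fin 3 → ℂ) (D : Set ℂ) (y k1 k2 : ℂ → ℂ) : Prop :=
  ∃ (c1 c2 : ℂ) (L1 L2 : ℂ → ℂ), c1 ≠ 0 ∧ c2 ≠ 0 ∧ ∀ x ∈ D,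
    HasDerivAt L1 (l1 θ x (y x) (deriv y x)) x ∧
    HasDerivAt L2 (l2 θ x (y x) (deriv y x)) x ∧
    k1 x = c1 * exp (L1 x) ∧ k2 x = c2 * exp (L2 x)

/-- `y` and `Ω` are related by the explicit formulae on `D`. -/
def OmegaFormulae (θ : Fin 3 → ℂ) (θinf : ℂ) (D : Set ℂ) (y : ℂ → ℂ) (Ω : ℂ → Mat3) : Prop :=
  ∃ k1 k2 : ℂ → ℂ, GivenByQuadratures θ D y k1 k2 ∧
    ∀ x ∈ D, Ω x = explicitOmega θ θinf x (y x) (deriv y x) (k1 x) (k2 x)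

/-- `y` and `V` are related by the explicit formulae and `V = (u₃-u₁)^Θ Ω(x) (u₃-u₁)^(-Θ)`. -/
def VFormulae (θ : Fin 3 → ℂ) (θinf : ℂ) (𝔻 : Set (Fin 3 → ℂ)) (L : (Fin 3 → ℂ) → ℂ)
    (y : ℂ → ℂ) (V : (Fin 3 → ℂ) → Mat3) : Prop :=
  ∃ Ω : ℂ → Mat3, OmegaFormulae θ θinf (xOf '' 𝔻) y Ω ∧
    ∀ u ∈ 𝔻, V u = powConj θ (L u) (Ω (xOf u))

/-! ### Transcendents and equivalence classes -/

/-- `B = K⁰ A (K⁰)⁻¹` on `S`, with a constant `K⁰ = diag(k₁⁰, k₂⁰, 1)`, `k₁⁰, k₂⁰ ≠ 0`. -/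
def DiagConj {α : Type*} (S : Set α) (A B : α → Mat3) : Prop :=
  ∃ c1 c2 : ℂ, c1 ≠ 0 ∧ c2 ≠ 0 ∧
    ∀ s ∈ S, B s = Matrix.diagonal ![c1, c2, 1] * A s * Matrix.diagonal ![c1⁻¹, c2⁻¹, 1]

theorem diagConj_equivalence {α : Type*} (S : Set α) : Equivalence (DiagConj S) := by
  have key : ∀ (a b c d : ℂ), Matrix.diagonal ![a, b, 1] * Matrix.diagonal ![c, d, 1]
      = (Matrix.diagonal ![a * c, b * d, 1] : Mat3) := by
    intro a b c d
    rw [Matrix.diagonal_mul_diagonal]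
    congr 1
    funext i
    fin_cases i <;> simp
  have key1 : (Matrix.diagonal ![1, 1, 1] : Mat3) = 1 := by
    rw [← Matrix.diagonal_one]
    congr 1
    funext i
    fin_cases i <;> simp
  refine ⟨fun A => ⟨1, 1, one_ne_zero, one_ne_zero, fun s _ => ?_⟩, ?_, ?_⟩
  · simp [key1]
  · rintro A B ⟨c1, c2, h1, h2, h⟩
    refine ⟨c1⁻¹, c2⁻¹, inv_ne_zero h1, inv_ne_zero h2, fun s hs => ?_⟩
    rw [h s hs]
    simp only [← Matrix.mul_assoc]
    rw [key]
    simp only [Matrix.mul_assoc]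
    rw [key]
    simp [h1, h2, key1]
  · rintro A B C ⟨c1, c2, h1, h2, h⟩ ⟨d1, d2, g1, g2, g⟩
    refine ⟨d1 * c1, d2 * c2, mul_ne_zero g1 h1, mul_ne_zero g2 h2, fun s hs => ?_⟩
    rw [g s hs, h s hs]
    simp only [← Matrix.mul_assoc]
    rw [key]
    simp only [Matrix.mul_assoc]
    rw [key]
    simp [mul_comm]

/-- Transcendents on `D`, two of them being identified when they agree on `D`. -/
def transcendentSetoid (θ : Fin 3 → ℂ) (θinf : ℂ) (D : Set ℂ) :
    Setoid {y : ℂ → ℂ // IsTranscendent θ θinf D y} where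
  r y₁ y₂ := Set.EqOn y₁.1 y₂.1 D
  iseqv := ⟨fun y => Set.eqOn_refl y.1 D, fun h => h.symm, fun h g => h.trans g⟩

/-- Nondegenerate constrained solutions of the reduced system on `D`, up to constant diagonal
conjugation. -/
def omegaSetoid (θ : Fin 3 → ℂ) (θinf : ℂ) (D : Set ℂ) :
    Setoid {Ω : ℂ → Mat3 // IsOmegaSolution θ θinf D Ω ∧
      ∀ x ∈ D, Nondegenerate θ θinf ![0, x, 1] (Ω x)} where
  r Ω₁ Ω₂ := DiagConj D Ω₁.1 Ω₂.1
  iseqv := ⟨fun A => (diagConj_equivalence D).refl A.1, fun h => (diagConj_equivalence D).symm h,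
    fun h g => (diagConj_equivalence D).trans h g⟩

/-- Nondegenerate constrained solutions of the deformation equations on `𝔻`, up to constant
diagonal conjugation. -/
def vSetoid (θ : Fin 3 → ℂ) (θinf : ℂ) (𝔻 : Set (Fin 3 → ℂ)) :
    Setoid {V : (Fin 3 → ℂ) → Mat3 // IsVSolution θ θinf 𝔻 V ∧
      ∀ u ∈ 𝔻, Nondegenerate θ θinf u (V u)} where
  r V₁ V₂ := DiagConj 𝔻 V₁.1 V₂.1
  iseqv := ⟨fun A => (diagConj_equivalence 𝔻).refl A.1, fun h => (diagConj_equivalence 𝔻).symm h,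
    fun h g => (diagConj_equivalence 𝔻).trans h g⟩

end PainleveSix

open PainleveSix

/-!
The proof rests on the eigenvectors of the explicit matrices. For `y ∉ {0, 1, x}` and nonzero `k₁`,
`k₂`, the matrix `explicitOmega` has the right eigenvector `(k₁, k₂, 1)` of eigenvalue `μ₃` and the
left eigenvector `(y / (x k₁), (y - x) / (x (x - 1) k₂), (y - 1) / (1 - x))` of eigenvalue `μ₁`. The
three eigenvalues `0`, `μ₁`, `μ₃` are distinct, so these eigenvectors are unique up to factors, and
the matrix determines `y`, `k₁`, `k₂` (`Admissible.eq_of_eigenvectors`). Conversely, matrices with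
given diagonal and given eigenvectors without zero entries form a line
(`eq_zero_of_mulVec_of_vecMul`), whose parameter is `p`; hence every nondegenerate constrained
matrix is explicit (`exists_eq_explicitOmega`).

The reduced system `Ω' = [Ω, H]`, with `H = omegaHat`, moves a right eigenvector `r` by `r' = -H r`
and a left one `l` by `l' = l H`, up to multiples. For the explicit eigenvectors these
equations say exactly that `y' = p` and `kⱼ' = lⱼ kⱼ` (`hasDerivAt_of_reduced`), and what remains of
the system is one entry, which is the sixth Painlevé equation (`Admissible.entry_flow`). Holomorphy of `y`, `k₁`, `k₂` holds because
the columns of `Ω (Ω - μ₁)` and the rows of `Ω (Ω - μ₃)` are eigenvectors by the Cayley-Hamilton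
theorem; the same polynomial eigenvectors detect degeneracy by the zeros of a holomorphic function
and exhibit `y` as a meromorphic function (`exists_meromorphic_transcendent`).

With `s = u₃ - u₁` and `W = s^(-Θ) V s^Θ`, the deformation equations become `dW = [W, Ŵ] dx`
(`deformationEq_powConj_iff`), so `W` is a function of `x` wherever the fibres of `x` are connected,
and this function solves the reduced system. Frobenius integrability reduces to the deformation
equations by comparing powers of `z` (`frobeniusIntegrable_iff`).

The bijections follow because the quadratures determine `k₁`, `k₂` up to constants
(`eqOn_iff_diagConj`). On the image of a convex set under `x` all holomorphic functions have
primitives, since the pullback of `f(x) dx` to the convex set is exact (`isExactOn_image_xOf`).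
-/

namespace PainleveSix

variable {θ : Fin 3 → ℂ} {θinf : ℂ}

/-! ### Linear algebra of `3 × 3` matrices -/

theorem vecMul_eq_smul_iff {A : Mat3} {l : Fin 3 → ℂ} {a : ℂ} :
    Matrix.vecMul l A = a • l ↔ ∀ j, l 0 * A 0 j + l 1 * A 1 j + l 2 * A 2 j = a * l j := by
  simp [funext_iff, Matrix.vecMul, dotProduct, Fin.sum_univ_three]

theorem mulVec_eq_smul_iff {A : Mat3} {r : Fin 3 → ℂ} {a : ℂ} :
    Matrix.mulVec A r = a • r ↔ ∀ i, A i 0 * r 0 + A i 1 * r 1 + A i 2 * r 2 = a * r i := by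
  simp [funext_iff, Matrix.mulVec, dotProduct, Fin.sum_univ_three]

theorem sum_mul_eq_zero_of_eigenvectors {A : Mat3} {l r : Fin 3 → ℂ} {a b : ℂ}
    (hl : Matrix.vecMul l A = a • l) (hr : Matrix.mulVec A r = b • r) (hab : a ≠ b) :
    l 0 * r 0 + l 1 * r 1 + l 2 * r 2 = 0 := by
  have h : l ⬝ᵥ A.mulVec r = Matrix.vecMul l A ⬝ᵥ r := Matrix.dotProduct_mulVec _ _ _
  rw [hl, hr, smul_dotProduct, dotProduct_smul, smul_eq_mul, smul_eq_mul] at h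
  have h2 : (a - b) * (l ⬝ᵥ r) = 0 := by linear_combination -h
  rcases mul_eq_zero.1 h2 with h3 | h3
  · exact absurd (sub_eq_zero.1 h3) hab
  · simpa [dotProduct, Fin.sum_univ_three] using h3

/-- If `A` has a left eigenvector of eigenvalue `a` and a right eigenvector of eigenvalue `b`, both
without zero entries, and trace `a + b`, then the right eigenspace of `b ≠ 0` is a line: otherwise
it would be the kernel of `l`, so that the trace would be `a + 2 * b`. -/
theorem eq_smul_of_mulVec_eq_smul {A : Mat3} {l r v : Fin 3 → ℂ} {a b : ℂ}
    (hl : Matrix.vecMul l A = a • l) (hr : Matrix.mulVec A r = b • r) (hab : a ≠ b) (hb : b ≠ 0)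
    (htr : A 0 0 + A 1 1 + A 2 2 = a + b) (hlr : ∀ k, l k * r k ≠ 0)
    (hv : Matrix.mulVec A v = b • v) : ∀ k, v k = v 2 / r 2 * r k := by
  have hl0 : l 0 ≠ 0 := left_ne_zero_of_mul (hlr 0)
  have hl1 : l 1 ≠ 0 := left_ne_zero_of_mul (hlr 1)
  have hl2 : l 2 ≠ 0 := left_ne_zero_of_mul (hlr 2)
  have hr2 : r 2 ≠ 0 := right_ne_zero_of_mul (hlr 2)
  have e1 := sum_mul_eq_zero_of_eigenvectors hl hr hab
  have e2 := sum_mul_eq_zero_of_eigenvectors hl hv hab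
  rw [mulVec_eq_smul_iff] at hr hv
  rw [vecMul_eq_smul_iff] at hl
  set c := v 2 / r 2 with hc
  have hc' : v 2 = c * r 2 := by rw [hc]; field_simp
  set w : Fin 3 → ℂ := fun k => v k - c * r k with hw
  have w2 : w 2 = 0 := by simp [hw, hc']
  have hlw : l 0 * w 0 + l 1 * w 1 = 0 := by
    simp only [hw]; linear_combination e2 - c * e1 - l 2 * hc'
  have hAw : ∀ i, A i 0 * w 0 + A i 1 * w 1 = b * w i := by
    intro i
    simp only [hw]; linear_combination hv i - c * hr i - A i 2 * hc'
  have hw1 : w 1 = 0 := by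
    by_contra hne
    -- now `A - b` annihilates the kernel of `l`, so its rows are multiples `q i` of `l`
    have hw0 : w 0 = -(l 1 / l 0) * w 1 := by field_simp; linear_combination hlw
    have hrow : ∀ i, ∀ d0 d1 d2 : ℂ, d0 * w 0 + d1 * w 1 = w i →
        d0 * r 0 + d1 * r 1 + d2 * r 2 = r i →
        ∃ q, A i 0 - b * d0 = q * l 0 ∧ A i 1 - b * d1 = q * l 1 ∧ A i 2 - b * d2 = q * l 2 := by
      intro i d0 d1 d2 h1 h2
      have h3 : A i 1 - b * d1 = (A i 0 - b * d0) / l 0 * l 1 := by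
        apply mul_right_cancel₀ hne
        have := hAw i
        rw [← h1, hw0] at this
        linear_combination this
      refine ⟨(A i 0 - b * d0) / l 0, by field_simp, h3, ?_⟩
      apply mul_right_cancel₀ hr2
      have h4 : A i 0 - b * d0 = (A i 0 - b * d0) / l 0 * l 0 := by field_simp
      linear_combination hr i - b * h2 - r 1 * h3 - r 0 * h4 - (A i 0 - b * d0) / l 0 * e1
    obtain ⟨q0, p00, p01, p02⟩ := hrow 0 1 0 0 (by ring) (by ring)
    obtain ⟨q1, p10, p11, p12⟩ := hrow 1 0 1 0 (by ring) (by ring)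
    obtain ⟨q2, p20, p21, p22⟩ := hrow 2 0 0 1 (by rw [w2]; ring) (by ring)
    have h5 : q0 * l 0 + q1 * l 1 + q2 * l 2 = a - b := by
      apply mul_left_cancel₀ hl0
      linear_combination hl 0 - l 0 * p00 - l 1 * p10 - l 2 * p20
    exact hb (by linear_combination htr - p00 - p11 - p22 - h5)
  have hw0 : w 0 = 0 := by
    apply mul_left_cancel₀ hl0
    linear_combination hlw - l 1 * hw1
  intro k
  fin_cases k
  · exact sub_eq_zero.1 hw0
  · exact sub_eq_zero.1 hw1
  · exact sub_eq_zero.1 w2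

theorem eq_smul_of_vecMul_eq_smul {A : Mat3} {l r v : Fin 3 → ℂ} {a b : ℂ}
    (hl : Matrix.vecMul l A = a • l) (hr : Matrix.mulVec A r = b • r) (hab : a ≠ b) (ha : a ≠ 0)
    (htr : A 0 0 + A 1 1 + A 2 2 = a + b) (hlr : ∀ k, l k * r k ≠ 0)
    (hv : Matrix.vecMul v A = a • v) : ∀ k, v k = v 2 / l 2 * l k := by
  refine eq_smul_of_mulVec_eq_smul (A := A.transpose) (l := r) (a := b) ?_ ?_ hab.symm ha ?_
    (fun k => mul_comm (l k) (r k) ▸ hlr k) ?_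
  · rw [Matrix.vecMul_transpose, hr]
  · rw [Matrix.mulVec_transpose, hl]
  · simp only [Matrix.transpose_apply]; rw [htr, add_comm]
  · rw [Matrix.mulVec_transpose, hv]

/-- A matrix with zero diagonal that is annihilated by `l` from the left and by `r` from the right
lies on a line, provided that `l` and `r` have no zero entries; one more entry determines it. -/
theorem eq_zero_of_mulVec_of_vecMul {Z : Mat3} {l r : Fin 3 → ℂ}
    (hd : ∀ i, Z i i = 0) (h01 : Z 0 1 = 0) (hl : Matrix.vecMul l Z = 0)
    (hr : Matrix.mulVec Z r = 0) (hl0 : ∀ k, l k ≠ 0) (hr0 : ∀ k, r k ≠ 0) : Z = 0 := by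
  have hl' := vecMul_eq_smul_iff.1 (hl.trans (zero_smul ℂ l).symm)
  have hr' := mulVec_eq_smul_iff.1 (hr.trans (zero_smul ℂ r).symm)
  have d0 := hd 0
  have d1 := hd 1
  have d2 := hd 2
  have h02 : Z 0 2 = 0 := by
    have := hr' 0
    apply mul_right_cancel₀ (hr0 2)
    linear_combination this - r 0 * d0 - r 1 * h01
  have h21 : Z 2 1 = 0 := by
    have := hl' 1
    apply mul_left_cancel₀ (hl0 2)
    linear_combination this - l 0 * h01 - l 1 * d1
  have h20 : Z 2 0 = 0 := by
    have := hr' 2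
    apply mul_right_cancel₀ (hr0 0)
    linear_combination this - r 1 * h21 - r 2 * d2
  have h10 : Z 1 0 = 0 := by
    have := hl' 0
    apply mul_left_cancel₀ (hl0 1)
    linear_combination this - l 0 * d0 - l 2 * h20
  have h12 : Z 1 2 = 0 := by
    have := hr' 1
    apply mul_right_cancel₀ (hr0 2)
    linear_combination this - r 0 * h10 - r 1 * d1
  ext i j
  fin_cases i <;> fin_cases j <;> assumption

theorem charpoly_of_eigenvectors {A : Mat3} {l r : Fin 3 → ℂ} {a b : ℂ}
    (hl : Matrix.vecMul l A = a • l) (hr : Matrix.mulVec A r = b • r) (hl0 : l ≠ 0) (hr0 : r ≠ 0)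
    (hab : a ≠ b) (htr : A 0 0 + A 1 1 + A 2 2 = a + b) :
    A.charpoly = X * (X - C a) * (X - C b) := by
  have key : A.charpoly = X ^ 3 - C (A 0 0 + A 1 1 + A 2 2) * X ^ 2
      + C (A 0 0 * A 1 1 + A 0 0 * A 2 2 + A 1 1 * A 2 2
        - A 0 1 * A 1 0 - A 0 2 * A 2 0 - A 1 2 * A 2 1) * X - C A.det := by
    rw [Matrix.charpoly, Matrix.det_fin_three, Matrix.det_fin_three]
    simp
    ring
  have ha : A.charpoly.eval a = 0 := by
    rw [Matrix.eval_charpoly, ← Matrix.exists_vecMul_eq_zero_iff]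
    refine ⟨l, hl0, ?_⟩
    rw [Matrix.vecMul_sub, hl]
    ext j
    simp [Matrix.scalar_apply]
  have hb : A.charpoly.eval b = 0 := by
    rw [Matrix.eval_charpoly, ← Matrix.exists_mulVec_eq_zero_iff]
    refine ⟨r, hr0, ?_⟩
    rw [Matrix.sub_mulVec, hr]
    ext j
    simp [Matrix.scalar_apply]
  rw [key, htr] at ha hb ⊢
  simp only [eval_sub, eval_add, eval_mul, eval_pow, eval_X, eval_C] at ha hb
  set e := A 0 0 * A 1 1 + A 0 0 * A 2 2 + A 1 1 * A 2 2
        - A 0 1 * A 1 0 - A 0 2 * A 2 0 - A 1 2 * A 2 1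
  have he : e = a * b := by
    apply mul_left_cancel₀ (sub_ne_zero.2 hab)
    linear_combination ha - hb
  have hd : A.det = 0 := by linear_combination -ha + a * he
  rw [he, hd]
  simp only [map_add, map_mul, map_zero]
  ring

/-! ### The explicit matrices and their eigenvectors -/

/-- The right eigenvector of `explicitOmega` of eigenvalue `μ₃`. -/
def explicitRight (k1 k2 : ℂ) : Fin 3 → ℂ := ![k1, k2, 1]

/-- The left eigenvector of `explicitOmega` of eigenvalue `μ₁`. -/
noncomputable def explicitLeft (x y k1 k2 : ℂ) : Fin 3 → ℂ :=
  ![y / x / k1, (y - x) / (x * (x - 1)) / k2, (y - 1) / (1 - x)]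

/-- The values of the parameters at which the explicit formulae make sense. -/
structure Admissible (x y k1 k2 : ℂ) : Prop where
  x0 : x ≠ 0
  x1 : x ≠ 1
  y0 : y ≠ 0
  y1 : y ≠ 1
  yx : y ≠ x
  k1 : k1 ≠ 0
  k2 : k2 ≠ 0

theorem mu1_add_mu3 : mu1 θ θinf + mu3 θ θinf = -(θ 0 + θ 1 + θ 2) := by
  simp only [mu1, mu3, Fin.sum_univ_three]; ring

theorem mu1_ne_mu3 (hinf : θinf ≠ 0) : mu1 θ θinf ≠ mu3 θ θinf := by
  intro h
  apply hinf
  simp only [mu1, mu3] at h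
  linear_combination h

theorem mu1_ne_zero (hadd : θinf ≠ ∑ i, θ i) : mu1 θ θinf ≠ 0 := by
  intro h
  apply hadd
  simp only [mu1] at h
  linear_combination 2 * h

theorem mu3_ne_zero (hsub : θinf ≠ -∑ i, θ i) : mu3 θ θinf ≠ 0 := by
  intro h
  apply hsub
  simp only [mu3] at h
  linear_combination -2 * h

theorem trace_of_diag {A : Mat3} (hd : ∀ i, A i i = -θ i) :
    A 0 0 + A 1 1 + A 2 2 = mu1 θ θinf + mu3 θ θinf := by
  rw [mu1_add_mu3, hd, hd, hd]; ring

namespace Admissible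

variable {x y p k1 k2 : ℂ}

theorem x1' (h : Admissible x y k1 k2) : x - 1 ≠ 0 := sub_ne_zero.2 h.x1
theorem x1'' (h : Admissible x y k1 k2) : 1 - x ≠ 0 := sub_ne_zero.2 h.x1.symm
theorem y1' (h : Admissible x y k1 k2) : y - 1 ≠ 0 := sub_ne_zero.2 h.y1
theorem y1'' (h : Admissible x y k1 k2) : 1 - y ≠ 0 := sub_ne_zero.2 h.y1.symm
theorem yx' (h : Admissible x y k1 k2) : y - x ≠ 0 := sub_ne_zero.2 h.yx
theorem yx'' (h : Admissible x y k1 k2) : x - y ≠ 0 := sub_ne_zero.2 h.yx.symm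

theorem explicitRight_ne_zero (h : Admissible x y k1 k2) (i : Fin 3) :
    explicitRight k1 k2 i ≠ 0 := by
  fin_cases i
  · exact h.k1
  · exact h.k2
  · exact one_ne_zero

theorem explicitLeft_ne_zero (h : Admissible x y k1 k2) (i : Fin 3) :
    explicitLeft x y k1 k2 i ≠ 0 := by
  fin_cases i
  · exact div_ne_zero (div_ne_zero h.y0 h.x0) h.k1
  · exact div_ne_zero (div_ne_zero h.yx' (mul_ne_zero h.x0 h.x1')) h.k2
  · exact div_ne_zero h.y1' h.x1''

theorem mulVec_explicitOmega (h : Admissible x y k1 k2) :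
    Matrix.mulVec (explicitOmega θ θinf x y p k1 k2) (explicitRight k1 k2)
      = mu3 θ θinf • explicitRight k1 k2 := by
  have := h.x0; have := h.x1'; have := h.y0; have := h.y1'; have := h.yx'
  have := h.k1; have := h.k2; have := h.yx''; have := h.y1''
  rw [mulVec_eq_smul_iff]
  intro i
  fin_cases i <;>
    simp [explicitOmega, explicitRight, mu3, Fin.sum_univ_three] <;> field_simp <;> ring

theorem vecMul_explicitOmega (h : Admissible x y k1 k2) :
    Matrix.vecMul (explicitLeft x y k1 k2) (explicitOmega θ θinf x y p k1 k2)
      = mu1 θ θinf • explicitLeft x y k1 k2 := by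
  have := h.x0; have := h.x1'; have := h.y0; have := h.y1'; have := h.yx'
  have := h.k1; have := h.k2; have := h.yx''; have := h.y1''; have := h.x1''
  rw [vecMul_eq_smul_iff]
  intro i
  fin_cases i <;>
    simp [explicitOmega, explicitLeft, mu1, Fin.sum_univ_three] <;> field_simp <;> ring

end Admissible

theorem explicitOmega_diag (x y p k1 k2 : ℂ) (i : Fin 3) :
    explicitOmega θ θinf x y p k1 k2 i i = -θ i := by
  fin_cases i <;> rfl

namespace Admissible

variable {x y p k1 k2 : ℂ}

theorem explicitLeft_mul_explicitRight (h : Admissible x y k1 k2) :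
    explicitLeft x y k1 k2 0 * explicitRight k1 k2 0 = y / x ∧
    explicitLeft x y k1 k2 1 * explicitRight k1 k2 1 = (y - x) / (x * (x - 1)) ∧
    explicitLeft x y k1 k2 2 * explicitRight k1 k2 2 = (y - 1) / (1 - x) := by
  have := h.k1; have := h.k2
  refine ⟨?_, ?_, ?_⟩ <;> simp [explicitLeft, explicitRight] <;> field_simp

theorem constrained_explicitOmega (h : Admissible x y k1 k2) (hinf : θinf ≠ 0) :
    Constrained θ θinf (explicitOmega θ θinf x y p k1 k2) :=
  ⟨explicitOmega_diag x y p k1 k2,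
    charpoly_of_eigenvectors h.vecMul_explicitOmega h.mulVec_explicitOmega
      (fun h0 => h.explicitLeft_ne_zero 0 (congrFun h0 0))
      (fun h0 => h.explicitRight_ne_zero 0 (congrFun h0 0)) (mu1_ne_mu3 hinf)
      (trace_of_diag (explicitOmega_diag x y p k1 k2))⟩

theorem nondegenerate_explicitOmega (h : Admissible x y k1 k2) :
    Nondegenerate θ θinf ![0, x, 1] (explicitOmega θ θinf x y p k1 k2) := by
  refine ⟨explicitLeft x y k1 k2, explicitRight k1 k2, h.vecMul_explicitOmega,
    h.mulVec_explicitOmega,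
    fun k => mul_ne_zero (h.explicitLeft_ne_zero k) (h.explicitRight_ne_zero k), ?_⟩
  obtain ⟨_, e1, e2⟩ := h.explicitLeft_mul_explicitRight
  have := h.x0; have := h.x1'; have := h.x1''
  have h1 : x * ((y - x) / (x * (x - 1))) + (y - 1) / (1 - x) = -1 := by field_simp; ring
  rw [Fin.sum_univ_three, e1, e2]
  simp [h1]

/-- The parameters of `explicitOmega` are read off from any eigenvectors `l`, `r`: the value `y` is
the finite zero of `∑ₖ lₖ rₖ / (λ - uₖ)` with `u = (0, x, 1)`, and `k₁`, `k₂` are the ratios of the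
entries of `r`. -/
theorem eq_of_eigenvectors (h : Admissible x y k1 k2) (hinf : θinf ≠ 0)
    (hadd : θinf ≠ ∑ i, θ i) (hsub : θinf ≠ -∑ i, θ i) {l r : Fin 3 → ℂ}
    (hl : Matrix.vecMul l (explicitOmega θ θinf x y p k1 k2) = mu1 θ θinf • l)
    (hr : Matrix.mulVec (explicitOmega θ θinf x y p k1 k2) r = mu3 θ θinf • r)
    (hl2 : l 2 ≠ 0) (hr2 : r 2 ≠ 0) :
    k1 = r 0 / r 2 ∧ k2 = r 1 / r 2 ∧ x * (l 1 * r 1) + l 2 * r 2 ≠ 0 ∧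
      y = -(x * (l 0 * r 0)) / (x * (l 1 * r 1) + l 2 * r 2) := by
  have hlr : ∀ k, explicitLeft x y k1 k2 k * explicitRight k1 k2 k ≠ 0 :=
    fun k => mul_ne_zero (h.explicitLeft_ne_zero k) (h.explicitRight_ne_zero k)
  have htr := trace_of_diag (θinf := θinf) (explicitOmega_diag (θ := θ) (θinf := θinf) x y p k1 k2)
  have R := eq_smul_of_mulVec_eq_smul h.vecMul_explicitOmega h.mulVec_explicitOmega
    (mu1_ne_mu3 hinf) (mu3_ne_zero hsub) htr hlr hr
  have L := eq_smul_of_vecMul_eq_smul h.vecMul_explicitOmega h.mulVec_explicitOmega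
    (mu1_ne_mu3 hinf) (mu1_ne_zero hadd) htr hlr hl
  have hy2 := h.explicitLeft_ne_zero 2
  set s := l 2 / explicitLeft x y k1 k2 2 with hs
  have s0 : s ≠ 0 := div_ne_zero hl2 hy2
  have R0 : r 0 = r 2 * k1 := by simpa [explicitRight] using R 0
  have R1 : r 1 = r 2 * k2 := by simpa [explicitRight] using R 1
  obtain ⟨e0, e1, e2⟩ := h.explicitLeft_mul_explicitRight
  have c : ∀ k, l k * r k = s * r 2 * (explicitLeft x y k1 k2 k * explicitRight k1 k2 k) := by
    intro k
    have : explicitRight k1 k2 2 = 1 := rfl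
    rw [L k, R k, this]; ring
  have := h.x0; have := h.x1'; have := h.x1''
  have h1 : x * ((y - x) / (x * (x - 1))) + (y - 1) / (1 - x) = -1 := by field_simp; ring
  have h2 : x * (l 1 * r 1) + l 2 * r 2 = -(s * r 2) := by
    rw [c 1, c 2, e1, e2]; linear_combination s * r 2 * h1
  refine ⟨by rw [R0]; field_simp, by rw [R1]; field_simp, ?_, ?_⟩
  · rw [h2]; exact neg_ne_zero.2 (mul_ne_zero s0 hr2)
  · rw [h2, c 0, e0]; field_simp

end Admissible

/-- A constrained matrix that is nondegenerate at `(0, x, 1)` is given by the explicit formulae. -/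
theorem exists_eq_explicitOmega {x : ℂ} (hx0 : x ≠ 0) (hx1 : x ≠ 1) (hinf : θinf ≠ 0) {A : Mat3}
    (hd : ∀ i, A i i = -θ i) (hA : Nondegenerate θ θinf ![0, x, 1] A) :
    ∃ y p k1 k2, Admissible x y k1 k2 ∧ A = explicitOmega θ θinf x y p k1 k2 := by
  obtain ⟨l, r, hl, hr, hlr, hs⟩ := hA
  have hsum := sum_mul_eq_zero_of_eigenvectors hl hr (mu1_ne_mu3 hinf)
  have l0 : l 0 ≠ 0 := left_ne_zero_of_mul (hlr 0)
  have l1 : l 1 ≠ 0 := left_ne_zero_of_mul (hlr 1)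
  have l2 : l 2 ≠ 0 := left_ne_zero_of_mul (hlr 2)
  have r0 : r 0 ≠ 0 := right_ne_zero_of_mul (hlr 0)
  have r1 : r 1 ≠ 0 := right_ne_zero_of_mul (hlr 1)
  have r2 : r 2 ≠ 0 := right_ne_zero_of_mul (hlr 2)
  have hx1' : x - 1 ≠ 0 := sub_ne_zero.2 hx1
  have hx1'' : 1 - x ≠ 0 := sub_ne_zero.2 hx1.symm
  set s : ℂ := -(x * (l 1 * r 1) + l 2 * r 2) with hsdef
  have s0 : s ≠ 0 := by
    rw [hsdef]
    refine neg_ne_zero.2 ?_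
    simpa [Fin.sum_univ_three] using hs
  obtain ⟨y, hy⟩ : ∃ y, y = x * (l 0 * r 0) / s := ⟨_, rfl⟩
  have hys : y * s = x * (l 0 * r 0) := by rw [hy]; field_simp
  -- the vanishing of `∑ lₖ rₖ` turns the residues at the poles into values of `y`
  have hyx : (y - x) * s = x * (x - 1) * (l 1 * r 1) := by
    rw [hsdef] at hys ⊢; linear_combination hys + x * hsum
  have hy1 : (y - 1) * s = (1 - x) * (l 2 * r 2) := by
    rw [hsdef] at hys ⊢; linear_combination hys + x * hsum
  have had : Admissible x y (r 0 / r 2) (r 1 / r 2) := by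
    refine ⟨hx0, hx1, ?_, ?_, ?_, div_ne_zero r0 r2, div_ne_zero r1 r2⟩
    · rw [hy]; exact div_ne_zero (mul_ne_zero hx0 (hlr 0)) s0
    · intro h; rw [h] at hy1
      exact mul_ne_zero hx1'' (hlr 2) (by linear_combination -hy1)
    · intro h; rw [h] at hyx
      exact mul_ne_zero (mul_ne_zero hx0 hx1') (hlr 1) (by linear_combination -hyx)
  have hR : ∀ k, explicitRight (r 0 / r 2) (r 1 / r 2) k = (r 2)⁻¹ * r k := by
    intro k
    fin_cases k <;> simp [explicitRight, r2] <;> field_simp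
  have hL : ∀ k, explicitLeft x y (r 0 / r 2) (r 1 / r 2) k = r 2 / s * l k := by
    intro k
    fin_cases k
    · simp [explicitLeft]; field_simp; linear_combination hys
    · simp [explicitLeft]; field_simp; linear_combination hyx
    · simp [explicitLeft]; field_simp; linear_combination hy1
  have hAr : Matrix.mulVec A (explicitRight (r 0 / r 2) (r 1 / r 2))
      = mu3 θ θinf • explicitRight (r 0 / r 2) (r 1 / r 2) := by
    rw [mulVec_eq_smul_iff] at hr ⊢
    intro i
    simp only [hR]; linear_combination (r 2)⁻¹ * hr i
  have hlA : Matrix.vecMul (explicitLeft x y (r 0 / r 2) (r 1 / r 2)) A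
      = mu1 θ θinf • explicitLeft x y (r 0 / r 2) (r 1 / r 2) := by
    rw [vecMul_eq_smul_iff] at hl ⊢
    intro i
    simp only [hL]; linear_combination r 2 / s * hl i
  generalize r 0 / r 2 = k1 at *
  generalize r 1 / r 2 = k2 at *
  have hk1 := had.k1
  have hk2 := had.k2
  have hy0 := had.y0
  -- `p` is chosen so that the entry `(1, 2)` is right
  refine ⟨y, (A 0 1 * (k2 / k1) * (2 * (x - 1) * y) - ((θinf - 1) * y ^ 2
        + (θ 1 - θ 0 + 1 - (θinf + θ 1) * x) * y + θ 0 * x)) / (x ^ 2 - x), k1, k2, had, ?_⟩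
  refine sub_eq_zero.1 (eq_zero_of_mulVec_of_vecMul (l := explicitLeft x y k1 k2)
    (r := explicitRight k1 k2) ?_ ?_ ?_ ?_ had.explicitLeft_ne_zero had.explicitRight_ne_zero)
  · intro i
    rw [Matrix.sub_apply, hd, explicitOmega_diag, sub_self]
  · have hxx : x ^ 2 - x ≠ 0 := by
      have : x ^ 2 - x = x * (x - 1) := by ring
      rw [this]; exact mul_ne_zero hx0 hx1'
    simp only [Matrix.sub_apply, explicitOmega, Matrix.of_apply, Matrix.cons_val']
    simp
    field_simp
    ring
  · rw [Matrix.vecMul_sub, hlA, had.vecMul_explicitOmega, sub_self]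
  · rw [Matrix.sub_mulVec, hAr, had.mulVec_explicitOmega, sub_self]

/-! ### Eigenvectors along the flow -/

theorem commutator_mulVec {A H : Mat3} {r : Fin 3 → ℂ} {b : ℂ} (hr : Matrix.mulVec A r = b • r)
    (r' : Fin 3 → ℂ) :
    Matrix.mulVec (A * H - H * A) r + Matrix.mulVec A r' - b • r'
      = Matrix.mulVec A (r' + Matrix.mulVec H r) - b • (r' + Matrix.mulVec H r) := by
  rw [Matrix.sub_mulVec, ← Matrix.mulVec_mulVec, ← Matrix.mulVec_mulVec, hr, Matrix.mulVec_smul,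
    Matrix.mulVec_add, smul_add]
  abel

theorem commutator_vecMul {A H : Mat3} {l : Fin 3 → ℂ} {a : ℂ} (hl : Matrix.vecMul l A = a • l)
    (l' : Fin 3 → ℂ) :
    Matrix.vecMul l (A * H - H * A) + Matrix.vecMul l' A - a • l'
      = Matrix.vecMul (l' - Matrix.vecMul l H) A - a • (l' - Matrix.vecMul l H) := by
  rw [Matrix.vecMul_sub, ← Matrix.vecMul_vecMul, ← Matrix.vecMul_vecMul, hl, Matrix.smul_vecMul,
    Matrix.sub_vecMul, smul_sub]
  abel

theorem mulVec_add_mulVec_of_hasDerivAt {A : ℂ → Mat3} {r : ℂ → Fin 3 → ℂ} {A' : Mat3}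
    {r' : Fin 3 → ℂ} {b x : ℂ} (hA : ∀ i j, HasDerivAt (fun t => A t i j) (A' i j) x)
    (hr : ∀ i, HasDerivAt (fun t => r t i) (r' i) x)
    (h : ∀ᶠ t in nhds x, Matrix.mulVec (A t) (r t) = b • r t) :
    Matrix.mulVec A' (r x) + Matrix.mulVec (A x) r' = b • r' := by
  ext i
  have h1 : HasDerivAt (fun t => ∑ j, A t i j * r t j)
      (∑ j, (A' i j * r x j + A x i j * r' j)) x :=
    HasDerivAt.fun_sum fun j _ => (hA i j).mul (hr j)
  have h2 : HasDerivAt (fun t => b * r t i) (b * r' i) x := (hr i).const_mul b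
  have h3 : (fun t => ∑ j, A t i j * r t j) =ᶠ[nhds x] fun t => b * r t i :=
    h.mono fun t ht => congrFun ht i
  have := (h2.congr_of_eventuallyEq h3).unique h1
  rw [Finset.sum_add_distrib] at this
  exact this.symm

theorem vecMul_add_vecMul_of_hasDerivAt {A : ℂ → Mat3} {l : ℂ → Fin 3 → ℂ} {A' : Mat3}
    {l' : Fin 3 → ℂ} {a x : ℂ} (hA : ∀ i j, HasDerivAt (fun t => A t i j) (A' i j) x)
    (hl : ∀ i, HasDerivAt (fun t => l t i) (l' i) x)
    (h : ∀ᶠ t in nhds x, Matrix.vecMul (l t) (A t) = a • l t) :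
    Matrix.vecMul (l x) A' + Matrix.vecMul l' (A x) = a • l' := by
  have := mulVec_add_mulVec_of_hasDerivAt (A := fun t => (A t).transpose) (A' := A'.transpose)
    (fun i j => hA j i) hl (b := a) (by simpa only [Matrix.mulVec_transpose] using h)
  simpa only [Matrix.mulVec_transpose] using this

/-- The derivative of `explicitLeft` along a curve, with `y' = q`, `k₁' = m₁`, `k₂' = m₂`. -/
noncomputable def explicitLeftDeriv (x y k1 k2 q m1 m2 : ℂ) : Fin 3 → ℂ :=
  ![(q / x - y / x ^ 2) / k1 - y / x * m1 / k1 ^ 2,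
    ((q - 1) / (x * (x - 1)) - (y - x) * (2 * x - 1) / (x * (x - 1)) ^ 2) / k2
      - (y - x) / (x * (x - 1)) * m2 / k2 ^ 2,
    q / (1 - x) + (y - 1) / (1 - x) ^ 2]

/-- The derivative of the entry `(1, 2)` of `explicitOmega` along a curve, with `y' = q`, `p' = s`,
`k₁' = m₁`, `k₂' = m₂`. -/
noncomputable def explicitOmegaDeriv (θ : Fin 3 → ℂ) (θinf x y p k1 k2 q s m1 m2 : ℂ) : ℂ :=
  (m1 * k2 - k1 * m2) / k2 ^ 2 * (((x ^ 2 - x) * p + (θinf - 1) * y ^ 2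
        + (θ 1 - θ 0 + 1 - (θinf + θ 1) * x) * y + θ 0 * x) / (2 * (x - 1) * y))
    + k1 / k2 * ((((2 * x - 1) * p + (x ^ 2 - x) * s + (θinf - 1) * (2 * y * q)
        - (θinf + θ 1) * y + (θ 1 - θ 0 + 1 - (θinf + θ 1) * x) * q + θ 0) * (2 * (x - 1) * y)
      - ((x ^ 2 - x) * p + (θinf - 1) * y ^ 2
        + (θ 1 - θ 0 + 1 - (θinf + θ 1) * x) * y + θ 0 * x) * (2 * y + 2 * (x - 1) * q))
      / (2 * (x - 1) * y) ^ 2)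

namespace Admissible

variable {x : ℂ} {y p k1 k2 : ℂ → ℂ} {q s m1 m2 : ℂ}

theorem hasDerivAt_explicitRight (hk1 : HasDerivAt k1 m1 x) (hk2 : HasDerivAt k2 m2 x)
    (i : Fin 3) :
    HasDerivAt (fun t => explicitRight (k1 t) (k2 t) i) (![m1, m2, 0] i) x := by
  fin_cases i
  · exact hk1
  · exact hk2
  · exact hasDerivAt_const x 1

theorem hasDerivAt_explicitLeft (h : Admissible x (y x) (k1 x) (k2 x)) (hy : HasDerivAt y q x)
    (hk1 : HasDerivAt k1 m1 x) (hk2 : HasDerivAt k2 m2 x) (i : Fin 3) :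
    HasDerivAt (fun t => explicitLeft t (y t) (k1 t) (k2 t) i)
      (explicitLeftDeriv x (y x) (k1 x) (k2 x) q m1 m2 i) x := by
  have h0 := h.x0; have h1 := h.x1'; have h2 := h.x1''; have h3 := h.k1; have h4 := h.k2
  have hx := hasDerivAt_id' x
  fin_cases i
  · refine ((hy.fun_div hx h0).fun_div hk1 h3).congr_deriv ?_
    simp [explicitLeftDeriv]; field_simp
  · refine (((hy.fun_sub hx).fun_div (hx.fun_mul (hx.fun_sub (hasDerivAt_const x 1)))
      (mul_ne_zero h0 h1)).fun_div hk2 h4).congr_deriv ?_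
    simp [explicitLeftDeriv]; field_simp; ring
  · refine ((hy.fun_sub (hasDerivAt_const x 1)).fun_div
      ((hasDerivAt_const x (1 : ℂ)).fun_sub hx) h2).congr_deriv ?_
    simp [explicitLeftDeriv]; field_simp; ring

theorem hasDerivAt_explicitOmega (h : Admissible x (y x) (k1 x) (k2 x)) (hy : HasDerivAt y q x)
    (hp : HasDerivAt p s x) (hk1 : HasDerivAt k1 m1 x) (hk2 : HasDerivAt k2 m2 x) :
    HasDerivAt (fun t => explicitOmega θ θinf t (y t) (p t) (k1 t) (k2 t) 0 1)
      (explicitOmegaDeriv θ θinf x (y x) (p x) (k1 x) (k2 x) q s m1 m2) x := by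
  have hx := hasDerivAt_id' x
  have c : ∀ a : ℂ, HasDerivAt (fun _ : ℂ => a) 0 x := fun a => hasDerivAt_const x a
  have hd : 2 * (x - 1) * y x ≠ 0 := mul_ne_zero (mul_ne_zero two_ne_zero h.x1') h.y0
  refine ((hk1.fun_div hk2 h.k2).fun_mul ((((((hx.fun_pow 2).fun_sub hx).fun_mul hp).fun_add
    ((c (θinf - 1)).fun_mul (hy.fun_pow 2))).fun_add
    (((c (θ 1 - θ 0 + 1)).fun_sub ((c (θinf + θ 1)).fun_mul hx)).fun_mul hy) |>.fun_add
    ((c (θ 0)).fun_mul hx)).fun_div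
      (((c 2).fun_mul (hx.fun_sub (c 1))).fun_mul hy) hd)).congr_deriv ?_
  simp only [explicitOmegaDeriv]
  push_cast
  ring

theorem differentiableAt_explicitOmega (h : Admissible x (y x) (k1 x) (k2 x))
    (hy : DifferentiableAt ℂ y x) (hp : DifferentiableAt ℂ p x) (hk1 : DifferentiableAt ℂ k1 x)
    (hk2 : DifferentiableAt ℂ k2 x) (i j : Fin 3) :
    DifferentiableAt ℂ (fun t => explicitOmega θ θinf t (y t) (p t) (k1 t) (k2 t) i j) x := by
  have h0 := h.x0; have h1 := h.x1'; have h2 := h.y0; have h3 := h.k1; have h4 := h.k2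
  have h5 := h.y1'; have h6 := h.y1''; have h7 := h.yx''
  fin_cases i <;> fin_cases j <;> simp [explicitOmega] <;>
    fun_prop (disch := simp [*])

end Admissible

namespace Admissible

variable {x y p k1 k2 : ℂ}

/-- With `k₁' = l₁ k₁` and `k₂' = l₂ k₂`, the right eigenvector `r` satisfies `r' = -H r` up to a
multiple of `r`, where `H = omegaHat`. -/
theorem right_flow (h : Admissible x y k1 k2) (i : Fin 3) :
    (![l1 θ x y p * k1, l2 θ x y p * k2, 0] : Fin 3 → ℂ) i
      + Matrix.mulVec (omegaHat x (explicitOmega θ θinf x y p k1 k2)) (explicitRight k1 k2) i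
    = Matrix.mulVec (omegaHat x (explicitOmega θ θinf x y p k1 k2)) (explicitRight k1 k2) 2
      * explicitRight k1 k2 i := by
  have := h.x0; have := h.x1'; have := h.y0; have := h.y1'; have := h.yx'
  have := h.k1; have := h.k2; have := h.yx''; have := h.y1''; have := h.x1''
  fin_cases i
  · simp [omegaHat, explicitOmega, explicitRight, l1, Matrix.mulVec, dotProduct,
      Fin.sum_univ_three]
    field_simp; ring
  · simp [omegaHat, explicitOmega, explicitRight, l2, Matrix.mulVec, dotProduct,
      Fin.sum_univ_three]
    field_simp; ring
  · simp [explicitRight]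

/-- With `y' = p`, `k₁' = l₁ k₁` and `k₂' = l₂ k₂`, the left eigenvector `l` satisfies `l' = l H` up
to a multiple of `l`, where `H = omegaHat`. -/
theorem left_flow (h : Admissible x y k1 k2) (i : Fin 3) :
    explicitLeftDeriv x y k1 k2 p (l1 θ x y p * k1) (l2 θ x y p * k2) i
      - Matrix.vecMul (explicitLeft x y k1 k2) (omegaHat x (explicitOmega θ θinf x y p k1 k2)) i
    = (explicitLeftDeriv x y k1 k2 p (l1 θ x y p * k1) (l2 θ x y p * k2) 2
      - Matrix.vecMul (explicitLeft x y k1 k2) (omegaHat x (explicitOmega θ θinf x y p k1 k2)) 2)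
      / explicitLeft x y k1 k2 2 * explicitLeft x y k1 k2 i := by
  have := h.x0; have := h.x1'; have := h.y0; have := h.y1'; have := h.yx'
  have := h.k1; have := h.k2; have := h.yx''; have := h.y1''; have := h.x1''
  fin_cases i
  · simp [omegaHat, explicitOmega, explicitLeft, explicitLeftDeriv, l1, l2, Matrix.vecMul,
      dotProduct, Fin.sum_univ_three]
    field_simp; ring
  · simp [omegaHat, explicitOmega, explicitLeft, explicitLeftDeriv, l1, l2, Matrix.vecMul,
      dotProduct, Fin.sum_univ_three]
    field_simp; ring
  · exact (div_mul_cancel₀ _ (h.explicitLeft_ne_zero 2)).symm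

/-- The entry `(1, 2)` of the reduced system is the sixth Painlevé equation. -/
theorem entry_flow (h : Admissible x y k1 k2) (s : ℂ) :
    explicitOmegaDeriv θ θinf x y p k1 k2 p s (l1 θ x y p * k1) (l2 θ x y p * k2)
      - (explicitOmega θ θinf x y p k1 k2 * omegaHat x (explicitOmega θ θinf x y p k1 k2)
        - omegaHat x (explicitOmega θ θinf x y p k1 k2) * explicitOmega θ θinf x y p k1 k2) 0 1
    = k1 / k2 * (x / (2 * y)) * (s - pviRhs ((θinf - 1) ^ 2 / 2) (-(θ 0) ^ 2 / 2) ((θ 2) ^ 2 / 2)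
        ((1 - (θ 1) ^ 2) / 2) x y p) := by
  have := h.x0; have := h.x1'; have := h.y0; have := h.y1'; have := h.yx'
  have := h.k1; have := h.k2; have := h.yx''; have := h.y1''; have := h.x1''
  simp [omegaHat, explicitOmega, explicitOmegaDeriv, l1, l2, pviRhs]
  field_simp; ring

end Admissible

/-! ### The reduced system and the sixth Painlevé equation -/

theorem omegaHat_commutator_diag (x : ℂ) (A : Mat3) (i : Fin 3) :
    (A * omegaHat x A - omegaHat x A * A) i i = 0 := by
  simp only [Matrix.sub_apply, Matrix.mul_apply, Fin.sum_univ_three]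
  fin_cases i <;> simp [omegaHat] <;> ring

/-- Along a transcendent, with `k₁`, `k₂` given by the quadratures, the explicit matrix solves the
reduced system: by the flows of the eigenvectors the defect in the system has the form to which
`eq_zero_of_mulVec_of_vecMul` applies, and its entry `(1, 2)` vanishes by the Painlevé equation. -/
theorem hasDerivAt_explicitOmega_of_pvi {x : ℂ} {y p k1 k2 : ℂ → ℂ}
    (had : ∀ᶠ t in nhds x, Admissible t (y t) (k1 t) (k2 t)) (hy : HasDerivAt y (p x) x)
    (hp : HasDerivAt p (pviRhs ((θinf - 1) ^ 2 / 2) (-(θ 0) ^ 2 / 2) ((θ 2) ^ 2 / 2)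
        ((1 - (θ 1) ^ 2) / 2) x (y x) (p x)) x)
    (hk1 : HasDerivAt k1 (l1 θ x (y x) (p x) * k1 x) x)
    (hk2 : HasDerivAt k2 (l2 θ x (y x) (p x) * k2 x) x) (i j : Fin 3) :
    HasDerivAt (fun t => explicitOmega θ θinf t (y t) (p t) (k1 t) (k2 t) i j)
      ((explicitOmega θ θinf x (y x) (p x) (k1 x) (k2 x)
          * omegaHat x (explicitOmega θ θinf x (y x) (p x) (k1 x) (k2 x))
        - omegaHat x (explicitOmega θ θinf x (y x) (p x) (k1 x) (k2 x))
          * explicitOmega θ θinf x (y x) (p x) (k1 x) (k2 x)) i j) x := by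
  have h := had.self_of_nhds
  have hA' : ∀ i j, HasDerivAt (fun t => explicitOmega θ θinf t (y t) (p t) (k1 t) (k2 t) i j)
      ((Matrix.of fun i j =>
        deriv (fun t => explicitOmega θ θinf t (y t) (p t) (k1 t) (k2 t) i j) x : Mat3) i j) x :=
    fun i j => (h.differentiableAt_explicitOmega hy.differentiableAt hp.differentiableAt
      hk1.differentiableAt hk2.differentiableAt i j).hasDerivAt
  generalize (Matrix.of fun i j =>
        deriv (fun t => explicitOmega θ θinf t (y t) (p t) (k1 t) (k2 t) i j) x : Mat3) = A' at hA'
  have R := mulVec_add_mulVec_of_hasDerivAt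
    (A := fun t => explicitOmega θ θinf t (y t) (p t) (k1 t) (k2 t)) hA'
    (r := fun t => explicitRight (k1 t) (k2 t)) (Admissible.hasDerivAt_explicitRight hk1 hk2)
    (had.mono fun t ht => ht.mulVec_explicitOmega)
  have L := vecMul_add_vecMul_of_hasDerivAt
    (A := fun t => explicitOmega θ θinf t (y t) (p t) (k1 t) (k2 t)) hA'
    (l := fun t => explicitLeft t (y t) (k1 t) (k2 t)) (h.hasDerivAt_explicitLeft hy hk1 hk2)
    (had.mono fun t ht => ht.vecMul_explicitOmega)
  have H01 := (hA' 0 1).unique (h.hasDerivAt_explicitOmega hy hp hk1 hk2)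
  have hdiag : ∀ i, A' i i = 0 := fun i => (hA' i i).unique (by
    simpa only [explicitOmega_diag] using hasDerivAt_const x (-θ i))
  have F01 := h.entry_flow (θ := θ) (θinf := θinf) (p := p x)
    (pviRhs ((θinf - 1) ^ 2 / 2) (-(θ 0) ^ 2 / 2) ((θ 2) ^ 2 / 2) ((1 - (θ 1) ^ 2) / 2) x (y x)
      (p x))
  rw [sub_self, mul_zero] at F01
  have FR := h.right_flow (θ := θ) (θinf := θinf) (p := p x)
  have FL := h.left_flow (θ := θ) (θinf := θinf) (p := p x)
  have ER := h.mulVec_explicitOmega (θ := θ) (θinf := θinf) (p := p x)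
  have EL := h.vecMul_explicitOmega (θ := θ) (θinf := θinf) (p := p x)
  have hdiag' := omegaHat_commutator_diag x (explicitOmega θ θinf x (y x) (p x) (k1 x) (k2 x))
  rw [← H01] at F01
  have hl0 := h.explicitLeft_ne_zero
  have hr0 := h.explicitRight_ne_zero
  beta_reduce at R L
  have key : A' - (explicitOmega θ θinf x (y x) (p x) (k1 x) (k2 x)
          * omegaHat x (explicitOmega θ θinf x (y x) (p x) (k1 x) (k2 x))
        - omegaHat x (explicitOmega θ θinf x (y x) (p x) (k1 x) (k2 x))
          * explicitOmega θ θinf x (y x) (p x) (k1 x) (k2 x)) = 0 := by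
    generalize explicitOmega θ θinf x (y x) (p x) (k1 x) (k2 x) = A at *
    generalize omegaHat x A = H at *
    generalize explicitLeft x (y x) (k1 x) (k2 x) = l at *
    generalize explicitRight (k1 x) (k2 x) = r at *
    generalize explicitLeftDeriv x (y x) (k1 x) (k2 x) (p x) _ _ = l' at *
    generalize (![l1 θ x (y x) (p x) * k1 x, l2 θ x (y x) (p x) * k2 x, 0] : Fin 3 → ℂ) = r' at *
    refine eq_zero_of_mulVec_of_vecMul (l := l) (r := r) ?_ ?_ ?_ ?_ hl0 hr0
    · intro i
      rw [Matrix.sub_apply, hdiag, hdiag', sub_zero]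
    · rw [Matrix.sub_apply]; exact F01
    · have C := commutator_vecMul (H := H) EL l'
      have e : l' - Matrix.vecMul l H = ((l' 2 - Matrix.vecMul l H 2) / l 2) • l :=
        funext fun i => FL i
      rw [e, Matrix.smul_vecMul, EL, smul_comm, sub_self] at C
      rw [Matrix.vecMul_sub, ← sub_eq_zero.2 L]
      linear_combination (exp := 1) -C
    · have C := commutator_mulVec (H := H) ER r'
      have e : r' + Matrix.mulVec H r = (Matrix.mulVec H r 2) • r := funext fun i => FR i
      rw [e, Matrix.mulVec_smul, ER, smul_comm, sub_self] at C
      rw [Matrix.sub_mulVec, ← sub_eq_zero.2 R]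
      linear_combination (exp := 1) -C
  rw [← sub_eq_zero.1 key]
  exact hA' i j

/-- Along a nondegenerate solution of the reduced system, `y' = p` and `k₁`, `k₂` are given by the
quadratures: the flow moves the eigenvectors by `-H` and `H`, up to multiples, because the
eigenspaces are lines. -/
theorem hasDerivAt_of_reduced {x : ℂ} {A : ℂ → Mat3} {y p k1 k2 : ℂ → ℂ} (hinf : θinf ≠ 0)
    (hadd : θinf ≠ ∑ i, θ i) (hsub : θinf ≠ -∑ i, θ i)
    (had : ∀ᶠ t in nhds x, Admissible t (y t) (k1 t) (k2 t) ∧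
      A t = explicitOmega θ θinf t (y t) (p t) (k1 t) (k2 t))
    (hA : ∀ i j, HasDerivAt (fun t => A t i j)
      ((A x * omegaHat x (A x) - omegaHat x (A x) * A x) i j) x)
    (hy : DifferentiableAt ℂ y x) (hk1 : DifferentiableAt ℂ k1 x)
    (hk2 : DifferentiableAt ℂ k2 x) :
    HasDerivAt y (p x) x ∧ HasDerivAt k1 (l1 θ x (y x) (p x) * k1 x) x ∧
      HasDerivAt k2 (l2 θ x (y x) (p x) * k2 x) x := by
  obtain ⟨h, hAx⟩ := had.self_of_nhds
  have R := mulVec_add_mulVec_of_hasDerivAt hA (r := fun t => explicitRight (k1 t) (k2 t))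
    (Admissible.hasDerivAt_explicitRight hk1.hasDerivAt hk2.hasDerivAt)
    (had.mono fun t ht => by rw [ht.2]; exact ht.1.mulVec_explicitOmega)
  have L := vecMul_add_vecMul_of_hasDerivAt hA (l := fun t => explicitLeft t (y t) (k1 t) (k2 t))
    (h.hasDerivAt_explicitLeft hy.hasDerivAt hk1.hasDerivAt hk2.hasDerivAt)
    (had.mono fun t ht => by rw [ht.2]; exact ht.1.vecMul_explicitOmega)
  have FR := h.right_flow (θ := θ) (θinf := θinf) (p := p x)
  have FL := h.left_flow (θ := θ) (θinf := θinf) (p := p x)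
  have ER := h.mulVec_explicitOmega (θ := θ) (θinf := θinf) (p := p x)
  have EL := h.vecMul_explicitOmega (θ := θ) (θinf := θinf) (p := p x)
  have htr := trace_of_diag (θinf := θinf)
    (explicitOmega_diag (θ := θ) (θinf := θinf) x (y x) (p x) (k1 x) (k2 x))
  have hlr : ∀ k, explicitLeft x (y x) (k1 x) (k2 x) k * explicitRight (k1 x) (k2 x) k ≠ 0 :=
    fun k => mul_ne_zero (h.explicitLeft_ne_zero k) (h.explicitRight_ne_zero k)
  rw [← hAx] at FR FL ER EL htr
  have CR := commutator_mulVec (H := omegaHat x (A x)) ER ![deriv k1 x, deriv k2 x, 0]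
  rw [R, sub_self] at CR
  have UR := eq_smul_of_mulVec_eq_smul EL ER (mu1_ne_mu3 hinf) (mu3_ne_zero hsub) htr hlr
    (sub_eq_zero.1 CR.symm)
  have e1 : deriv k1 x = l1 θ x (y x) (p x) * k1 x := by
    have a := UR 0
    have b := FR 0
    simp [explicitRight] at a b
    linear_combination a - b
  have e2 : deriv k2 x = l2 θ x (y x) (p x) * k2 x := by
    have a := UR 1
    have b := FR 1
    simp [explicitRight] at a b
    linear_combination a - b
  rw [e1, e2] at L
  have CL := commutator_vecMul (H := omegaHat x (A x)) EL
    (explicitLeftDeriv x (y x) (k1 x) (k2 x) (deriv y x) (l1 θ x (y x) (p x) * k1 x)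
      (l2 θ x (y x) (p x) * k2 x))
  rw [L, sub_self] at CL
  have UL := eq_smul_of_vecMul_eq_smul EL ER (mu1_ne_mu3 hinf) (mu1_ne_zero hadd) htr hlr
    (sub_eq_zero.1 CL.symm)
  have e3 : deriv y x = p x := by
    have a := UL 0
    have b := FL 0
    simp only [Pi.sub_apply] at a
    have hl2 := h.explicitLeft_ne_zero 2
    -- the difference of the two relations is a nonzero multiple of `y' - p`
    have c : (deriv y x - p x) / x / k1 x = (deriv y x - p x) / (1 - x)
        / explicitLeft x (y x) (k1 x) (k2 x) 2 * explicitLeft x (y x) (k1 x) (k2 x) 0 := by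
      have d0 : ∀ q, explicitLeftDeriv x (y x) (k1 x) (k2 x) q (l1 θ x (y x) (p x) * k1 x)
          (l2 θ x (y x) (p x) * k2 x) 0 = (q / x - y x / x ^ 2) / k1 x
            - y x / x * (l1 θ x (y x) (p x) * k1 x) / k1 x ^ 2 := fun q => rfl
      have d2 : ∀ q, explicitLeftDeriv x (y x) (k1 x) (k2 x) q (l1 θ x (y x) (p x) * k1 x)
          (l2 θ x (y x) (p x) * k2 x) 2 = q / (1 - x) + (y x - 1) / (1 - x) ^ 2 := fun q => rfl
      rw [d0, d2] at a b
      linear_combination a - b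
    have := h.x0; have := h.x1''; have := h.y1'; have := h.k1
    have f0 : explicitLeft x (y x) (k1 x) (k2 x) 0 = y x / x / k1 x := rfl
    have f2 : explicitLeft x (y x) (k1 x) (k2 x) 2 = (y x - 1) / (1 - x) := rfl
    rw [f0, f2] at c
    field_simp at c
    linear_combination -c
  rw [← e1, ← e2]
  exact ⟨e3 ▸ hy.hasDerivAt, hk1.hasDerivAt, hk2.hasDerivAt⟩

/-- Along a nondegenerate solution of the reduced system, `p' = y''` is given by the Painlevé
equation. -/
theorem deriv_eq_pviRhs_of_reduced {x : ℂ} {A : ℂ → Mat3} {y p k1 k2 : ℂ → ℂ}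
    (had : ∀ᶠ t in nhds x, Admissible t (y t) (k1 t) (k2 t) ∧
      A t = explicitOmega θ θinf t (y t) (p t) (k1 t) (k2 t))
    (hA : ∀ i j, HasDerivAt (fun t => A t i j)
      ((A x * omegaHat x (A x) - omegaHat x (A x) * A x) i j) x)
    (hy : HasDerivAt y (p x) x) (hp : DifferentiableAt ℂ p x)
    (hk1 : HasDerivAt k1 (l1 θ x (y x) (p x) * k1 x) x)
    (hk2 : HasDerivAt k2 (l2 θ x (y x) (p x) * k2 x) x) :
    deriv p x = pviRhs ((θinf - 1) ^ 2 / 2) (-(θ 0) ^ 2 / 2) ((θ 2) ^ 2 / 2)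
        ((1 - (θ 1) ^ 2) / 2) x (y x) (p x) := by
  obtain ⟨h, hAx⟩ := had.self_of_nhds
  have e := ((h.hasDerivAt_explicitOmega (θ := θ) (θinf := θinf) hy hp.hasDerivAt hk1
    hk2).congr_of_eventuallyEq (had.mono fun t ht => congrFun (congrFun ht.2 0) 1)).unique (hA 0 1)
  have f := h.entry_flow (θ := θ) (θinf := θinf) (p := p x) (deriv p x)
  rw [e, hAx, sub_self] at f
  refine sub_eq_zero.1 ((mul_eq_zero.1 f.symm).resolve_left (mul_ne_zero ?_ ?_))
  · exact div_ne_zero h.k1 h.k2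
  · exact div_ne_zero h.x0 (mul_ne_zero two_ne_zero h.y0)

/-! ### Eigenvectors that depend holomorphically on the matrix -/

/-- The `i`-th column of `A (A - μ₁)`; for constrained `A` it lies in the right eigenspace of
`μ₃`. -/
noncomputable def rightProj (θ : Fin 3 → ℂ) (θinf : ℂ) (A : Mat3) (i k : Fin 3) : ℂ :=
  (A * (A - mu1 θ θinf • (1 : Mat3))) k i

/-- The `j`-th row of `A (A - μ₃)`; for constrained `A` it lies in the left eigenspace of `μ₁`. -/
noncomputable def leftProj (θ : Fin 3 → ℂ) (θinf : ℂ) (A : Mat3) (j k : Fin 3) : ℂ :=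
  (A * (A - mu3 θ θinf • (1 : Mat3))) j k

/-- The Cayley-Hamilton theorem; the eigenvalue `0` contributes the factor `A`. -/
theorem Constrained.cayley_hamilton {A : Mat3} (hA : Constrained θ θinf A) :
    A * (A - mu1 θ θinf • (1 : Mat3)) * (A - mu3 θ θinf • (1 : Mat3)) = 0 := by
  have h := Matrix.aeval_self_charpoly A
  rw [hA.2] at h
  simpa [Algebra.algebraMap_eq_smul_one] using h

theorem Constrained.mulVec_rightProj {A : Mat3} (hA : Constrained θ θinf A) (i : Fin 3) :
    Matrix.mulVec A (rightProj θ θinf A i) = mu3 θ θinf • rightProj θ θinf A i := by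
  have h : A * (A * (A - mu1 θ θinf • (1 : Mat3)))
      = mu3 θ θinf • (A * (A - mu1 θ θinf • (1 : Mat3))) := by
    have := hA.cayley_hamilton
    rw [← sub_eq_zero, ← this]
    simp only [Matrix.mul_sub, Matrix.sub_mul, Matrix.mul_smul, Matrix.smul_mul, Matrix.mul_one,
      Matrix.mul_assoc, smul_sub]
  ext k
  exact congrFun (congrFun h k) i

theorem Constrained.vecMul_leftProj {A : Mat3} (hA : Constrained θ θinf A) (j : Fin 3) :
    Matrix.vecMul (leftProj θ θinf A j) A = mu1 θ θinf • leftProj θ θinf A j := by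
  have h : A * (A - mu3 θ θinf • (1 : Mat3)) * A
      = mu1 θ θinf • (A * (A - mu3 θ θinf • (1 : Mat3))) := by
    have := hA.cayley_hamilton
    rw [← sub_eq_zero, ← this]
    simp only [Matrix.mul_sub, Matrix.sub_mul, Matrix.mul_smul, Matrix.smul_mul, Matrix.mul_one,
      Matrix.mul_assoc, smul_sub, smul_smul]
    rw [mul_comm (mu3 θ θinf)]
    abel
  ext k
  exact congrFun (congrFun h j) k

theorem exists_rightProj_ne_zero (hinf : θinf ≠ 0) (hsub : θinf ≠ -∑ i, θ i) {A : Mat3}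
    {r : Fin 3 → ℂ} (hr : Matrix.mulVec A r = mu3 θ θinf • r) (hr2 : r 2 ≠ 0) :
    ∃ i, rightProj θ θinf A i 2 ≠ 0 := by
  by_contra! h
  have e : Matrix.mulVec (A * (A - mu1 θ θinf • (1 : Mat3))) r
      = (mu3 θ θinf * (mu3 θ θinf - mu1 θ θinf)) • r := by
    rw [← Matrix.mulVec_mulVec, Matrix.sub_mulVec, Matrix.smul_mulVec, Matrix.one_mulVec, hr,
      ← sub_smul, Matrix.mulVec_smul, hr, smul_smul, mul_comm]
  have e2 := congrFun e 2
  have : Matrix.mulVec (A * (A - mu1 θ θinf • (1 : Mat3))) r 2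
      = ∑ i, rightProj θ θinf A i 2 * r i := rfl
  rw [this] at e2
  simp only [h, zero_mul, Finset.sum_const_zero] at e2
  exact mul_ne_zero (mul_ne_zero (mu3_ne_zero hsub) (sub_ne_zero.2 (mu1_ne_mu3 hinf).symm)) hr2
    e2.symm

theorem exists_leftProj_ne_zero (hinf : θinf ≠ 0) (hadd : θinf ≠ ∑ i, θ i) {A : Mat3}
    {l : Fin 3 → ℂ} (hl : Matrix.vecMul l A = mu1 θ θinf • l) (hl2 : l 2 ≠ 0) :
    ∃ j, leftProj θ θinf A j 2 ≠ 0 := by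
  by_contra! h
  have e : Matrix.vecMul l (A * (A - mu3 θ θinf • (1 : Mat3)))
      = (mu1 θ θinf * (mu1 θ θinf - mu3 θ θinf)) • l := by
    rw [← Matrix.vecMul_vecMul, hl, Matrix.smul_vecMul, Matrix.vecMul_sub, Matrix.vecMul_smul,
      Matrix.vecMul_one, hl, ← sub_smul, smul_smul]
  have e2 := congrFun e 2
  have : Matrix.vecMul l (A * (A - mu3 θ θinf • (1 : Mat3))) 2
      = ∑ j, l j * leftProj θ θinf A j 2 := rfl
  rw [this] at e2
  simp only [h, mul_zero, Finset.sum_const_zero] at e2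
  exact mul_ne_zero (mul_ne_zero (mu1_ne_zero hadd) (sub_ne_zero.2 (mu1_ne_mu3 hinf))) hl2
    e2.symm

theorem differentiableAt_rightProj {A : ℂ → Mat3} {x : ℂ}
    (hA : ∀ i j, DifferentiableAt ℂ (fun t => A t i j) x) (i k : Fin 3) :
    DifferentiableAt ℂ (fun t => rightProj θ θinf (A t) i k) x := by
  simp only [rightProj, Matrix.mul_apply, Matrix.sub_apply, Fin.sum_univ_three]
  fun_prop

theorem differentiableAt_leftProj {A : ℂ → Mat3} {x : ℂ}
    (hA : ∀ i j, DifferentiableAt ℂ (fun t => A t i j) x) (i k : Fin 3) :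
    DifferentiableAt ℂ (fun t => leftProj θ θinf (A t) i k) x := by
  simp only [leftProj, Matrix.mul_apply, Matrix.sub_apply, Fin.sum_univ_three]
  fun_prop

/-- The parameters of a holomorphic family of explicit matrices are holomorphic. -/
theorem differentiableAt_parameters {x : ℂ} {A : ℂ → Mat3} {y p k1 k2 : ℂ → ℂ} (hinf : θinf ≠ 0)
    (hadd : θinf ≠ ∑ i, θ i) (hsub : θinf ≠ -∑ i, θ i)
    (had : ∀ᶠ t in nhds x, Admissible t (y t) (k1 t) (k2 t) ∧
      A t = explicitOmega θ θinf t (y t) (p t) (k1 t) (k2 t))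
    (hA : ∀ i j, DifferentiableAt ℂ (fun t => A t i j) x) :
    DifferentiableAt ℂ y x ∧ DifferentiableAt ℂ k1 x ∧ DifferentiableAt ℂ k2 x := by
  obtain ⟨h, hAx⟩ := had.self_of_nhds
  obtain ⟨i, hi⟩ := exists_rightProj_ne_zero (A := A x) hinf hsub
    (by rw [hAx]; exact h.mulVec_explicitOmega) (h.explicitRight_ne_zero 2)
  obtain ⟨j, hj⟩ := exists_leftProj_ne_zero (A := A x) hinf hadd
    (by rw [hAx]; exact h.vecMul_explicitOmega) (h.explicitLeft_ne_zero 2)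
  have hr := differentiableAt_rightProj (θ := θ) (θinf := θinf) hA i
  have hl := differentiableAt_leftProj (θ := θ) (θinf := θinf) hA j
  have key : ∀ᶠ t in nhds x,
      k1 t = rightProj θ θinf (A t) i 0 / rightProj θ θinf (A t) i 2 ∧
      k2 t = rightProj θ θinf (A t) i 1 / rightProj θ θinf (A t) i 2 ∧
      t * (leftProj θ θinf (A t) j 1 * rightProj θ θinf (A t) i 1)
        + leftProj θ θinf (A t) j 2 * rightProj θ θinf (A t) i 2 ≠ 0 ∧
      y t = -(t * (leftProj θ θinf (A t) j 0 * rightProj θ θinf (A t) i 0))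
        / (t * (leftProj θ θinf (A t) j 1 * rightProj θ θinf (A t) i 1)
        + leftProj θ θinf (A t) j 2 * rightProj θ θinf (A t) i 2) := by
    filter_upwards [had, (hr 2).continuousAt.eventually_ne hi,
      (hl 2).continuousAt.eventually_ne hj] with t ht h1 h2
    have hc : Constrained θ θinf (A t) := by
      rw [ht.2]; exact ht.1.constrained_explicitOmega hinf
    refine ht.1.eq_of_eigenvectors (p := p t) hinf hadd hsub ?_ ?_ h2 h1
    · rw [← ht.2]; exact hc.vecMul_leftProj j
    · rw [← ht.2]; exact hc.mulVec_rightProj i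
  have hne := key.self_of_nhds.2.2.1
  have hr0 := hr 0
  have hr1 := hr 1
  have hr2 := hr 2
  have hl0 := hl 0
  have hl1 := hl 1
  have hl2 := hl 2
  refine ⟨?_, ?_, ?_⟩
  · refine DifferentiableAt.congr_of_eventuallyEq ?_ (key.mono fun t ht => ht.2.2.2)
    exact DifferentiableAt.fun_div (by fun_prop) (by fun_prop) hne
  · exact (hr0.fun_div hr2 hi).congr_of_eventuallyEq (key.mono fun t ht => ht.1)
  · exact (hr1.fun_div hr2 hi).congr_of_eventuallyEq (key.mono fun t ht => ht.2.1)

/-! ### Solutions of the reduced system on an open set -/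

theorem SolvesQuadratures.admissible {D : Set ℂ} {y k1 k2 : ℂ → ℂ}
    (hD : ∀ x ∈ D, x ≠ 0 ∧ x ≠ 1) (hy : IsTranscendent θ θinf D y)
    (hk : SolvesQuadratures θ D y k1 k2) {x : ℂ} (hx : x ∈ D) :
    Admissible x (y x) (k1 x) (k2 x) :=
  ⟨(hD x hx).1, (hD x hx).2, (hy.2 x hx).1, (hy.2 x hx).2.1, (hy.2 x hx).2.2.1, (hk x hx).1,
    (hk x hx).2.1⟩

theorem isOmegaSolution_explicitOmega {D : Set ℂ} (hDo : IsOpen D)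
    (hD : ∀ x ∈ D, x ≠ 0 ∧ x ≠ 1) (hinf : θinf ≠ 0) {y k1 k2 : ℂ → ℂ}
    (hy : IsTranscendent θ θinf D y) (hk : SolvesQuadratures θ D y k1 k2) {Ω : ℂ → Mat3}
    (hΩ : ∀ x ∈ D, Ω x = explicitOmega θ θinf x (y x) (deriv y x) (k1 x) (k2 x)) :
    IsOmegaSolution θ θinf D Ω ∧ ∀ x ∈ D, Nondegenerate θ θinf ![0, x, 1] (Ω x) := by
  have had : ∀ x ∈ D, Admissible x (y x) (k1 x) (k2 x) := fun x hx => hk.admissible hD hy hx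
  refine ⟨⟨fun x hx i j => ?_, fun x hx => ?_⟩, fun x hx => ?_⟩
  · have hn : D ∈ nhds x := hDo.mem_nhds hx
    have hyx : HasDerivAt y (deriv y x) x := (hy.1.differentiableAt hn).hasDerivAt
    have hpx : HasDerivAt (deriv y) (deriv (deriv y) x) x :=
      ((hy.1.deriv hDo).differentiableAt hn).hasDerivAt
    rw [(hy.2 x hx).2.2.2] at hpx
    have := hasDerivAt_explicitOmega_of_pvi (Filter.mem_of_superset hn had) hyx hpx
      (hk x hx).2.2.1 (hk x hx).2.2.2 i j
    rw [hΩ x hx]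
    exact this.congr_of_eventuallyEq
      (Filter.mem_of_superset hn fun t ht => congrFun (congrFun (hΩ t ht) i) j)
  · rw [hΩ x hx]; exact (had x hx).constrained_explicitOmega hinf
  · rw [hΩ x hx]; exact (had x hx).nondegenerate_explicitOmega

/-- The parameters are chosen pointwise; since eigenvectors determine them, no choice has to be made
coherently and the resulting functions are holomorphic. -/
theorem exists_transcendent_of_isOmegaSolution {D : Set ℂ} (hDo : IsOpen D)
    (hD : ∀ x ∈ D, x ≠ 0 ∧ x ≠ 1) (hinf : θinf ≠ 0) (hadd : θinf ≠ ∑ i, θ i)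
    (hsub : θinf ≠ -∑ i, θ i) {Ω : ℂ → Mat3} (hΩ : IsOmegaSolution θ θinf D Ω)
    (hnd : ∀ x ∈ D, Nondegenerate θ θinf ![0, x, 1] (Ω x)) :
    ∃ y k1 k2 : ℂ → ℂ, IsTranscendent θ θinf D y ∧ SolvesQuadratures θ D y k1 k2 ∧
      ∀ x ∈ D, Ω x = explicitOmega θ θinf x (y x) (deriv y x) (k1 x) (k2 x) := by
  have ex : ∀ x, ∃ y p k1 k2, x ∈ D → Admissible x y k1 k2 ∧
      Ω x = explicitOmega θ θinf x y p k1 k2 := by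
    intro x
    by_cases hx : x ∈ D
    · obtain ⟨y, p, k1, k2, h⟩ :=
        exists_eq_explicitOmega (hD x hx).1 (hD x hx).2 hinf (hΩ.2 x hx).1 (hnd x hx)
      exact ⟨y, p, k1, k2, fun _ => h⟩
    · exact ⟨0, 0, 0, 0, fun h => absurd h hx⟩
  choose y p k1 k2 had using ex
  have had' : ∀ x ∈ D, ∀ᶠ t in nhds x, Admissible t (y t) (k1 t) (k2 t) ∧
      Ω t = explicitOmega θ θinf t (y t) (p t) (k1 t) (k2 t) :=
    fun x hx => Filter.mem_of_superset (hDo.mem_nhds hx) fun t ht => had t ht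
  have hdiff := fun x hx => differentiableAt_parameters hinf hadd hsub (had' x hx)
    fun i j => (hΩ.1 x hx i j).differentiableAt
  have hder := fun x hx => hasDerivAt_of_reduced hinf hadd hsub (had' x hx) (hΩ.1 x hx)
    (hdiff x hx).1 (hdiff x hx).2.1 (hdiff x hx).2.2
  have hyD : DifferentiableOn ℂ y D := fun x hx => (hdiff x hx).1.differentiableWithinAt
  have hp : ∀ x ∈ D, deriv y x = p x := fun x hx => (hder x hx).1.deriv
  refine ⟨y, k1, k2, ⟨hyD, fun x hx => ?_⟩, fun x hx => ?_, fun x hx => ?_⟩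
  · have hn : D ∈ nhds x := hDo.mem_nhds hx
    obtain ⟨h1, h2, h3⟩ := hder x hx
    have e : deriv y =ᶠ[nhds x] p := Filter.mem_of_superset hn hp
    have hpx : DifferentiableAt ℂ p x :=
      ((hyD.deriv hDo).differentiableAt hn).congr_of_eventuallyEq e.symm
    refine ⟨(had x hx).1.y0, (had x hx).1.y1, (had x hx).1.yx, ?_⟩
    rw [e.deriv_eq, hp x hx]
    exact deriv_eq_pviRhs_of_reduced (had' x hx) (hΩ.1 x hx) h1 hpx h2 h3
  · rw [hp x hx]
    exact ⟨(had x hx).1.k1, (had x hx).1.k2, (hder x hx).2⟩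
  · rw [hp x hx]
    exact (had x hx).2

/-! ### Integrability of the Pfaffian system -/

/-- `Vk` with an arbitrary vector `e` in place of the `k`-th basis vector. -/
noncomputable def offDiagQuotient (e u : Fin 3 → ℂ) (A : Mat3) : Mat3 :=
  Matrix.of fun i j => if i = j then 0 else A i j * (e i - e j) / (u i - u j)

theorem Vk_eq_offDiagQuotient (k : Fin 3) (u : Fin 3 → ℂ) (A : Mat3) :
    Vk k u A = offDiagQuotient (Pi.single k 1) u A := by
  ext i j
  simp [Vk, offDiagQuotient, Pi.single_apply]

theorem ne_of_disjoint {𝔻 : Set (Fin 3 → ℂ)} (h : Disjoint 𝔻 coalescenceLocus) {u : Fin 3 → ℂ}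
    (hu : u ∈ 𝔻) {i j : Fin 3} (hij : i ≠ j) : u i - u j ≠ 0 := fun h0 =>
  Set.disjoint_left.1 h hu ⟨i, j, hij, sub_eq_zero.1 h0⟩

theorem offDiagQuotient_commutator_diagonal (e f u : Fin 3 → ℂ) (A : Mat3) :
    Matrix.diagonal f * offDiagQuotient e u A - offDiagQuotient e u A * Matrix.diagonal f
      = Matrix.diagonal e * offDiagQuotient f u A - offDiagQuotient f u A * Matrix.diagonal e := by
  ext i j
  simp only [Matrix.sub_apply, Matrix.diagonal_mul, Matrix.mul_diagonal, offDiagQuotient,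
    Matrix.of_apply]
  split_ifs <;> ring

theorem offDiagQuotient_commutator_self {u : Fin 3 → ℂ} (hu : ∀ i j, i ≠ j → u i - u j ≠ 0)
    (e : Fin 3 → ℂ) (A : Mat3) :
    Matrix.diagonal u * offDiagQuotient e u A - offDiagQuotient e u A * Matrix.diagonal u
      = Matrix.diagonal e * A - A * Matrix.diagonal e := by
  ext i j
  simp only [Matrix.sub_apply, Matrix.diagonal_mul, Matrix.mul_diagonal, offDiagQuotient,
    Matrix.of_apply]
  split_ifs with h
  · subst h; ring
  · field_simp [hu i j h]

theorem offDiagQuotient_commutator_diag (e f u : Fin 3 → ℂ) (A : Mat3) (i : Fin 3) :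
    (offDiagQuotient e u A * offDiagQuotient f u A
      - offDiagQuotient f u A * offDiagQuotient e u A) i i = 0 := by
  simp only [Matrix.sub_apply, Matrix.mul_apply, Fin.sum_univ_three, offDiagQuotient,
    Matrix.of_apply]
  fin_cases i <;> simp <;> ring

/-- The compatibility of the deformation equations: with `offDiagQuotient_commutator_diag` it gives
the components of `dω = ω ∧ ω` along `duₖ ∧ duₘ`. The derivatives of `1 / (uᵢ - uⱼ)` do not
contribute, since their terms are symmetric in `e` and `f`. -/
theorem offDiagQuotient_commutator {u : Fin 3 → ℂ} (hu : ∀ i j, i ≠ j → u i - u j ≠ 0)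
    (e f : Fin 3 → ℂ) (A : Mat3) {i j : Fin 3} (hij : i ≠ j) :
    ((offDiagQuotient e u A * A - A * offDiagQuotient e u A) i j * (f i - f j)
        - (offDiagQuotient f u A * A - A * offDiagQuotient f u A) i j * (e i - e j)) / (u i - u j)
      = (offDiagQuotient e u A * offDiagQuotient f u A
      - offDiagQuotient f u A * offDiagQuotient e u A) i j := by
  have h01 := hu 0 1 (by decide)
  have h02 := hu 0 2 (by decide)
  have h12 := hu 1 2 (by decide)
  have h10 := hu 1 0 (by decide)
  have h20 := hu 2 0 (by decide)
  have h21 := hu 2 1 (by decide)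
  simp only [Matrix.sub_apply, Matrix.mul_apply, Fin.sum_univ_three, offDiagQuotient,
    Matrix.of_apply]
  fin_cases i <;> fin_cases j <;> first | exact absurd rfl hij | (simp; field_simp; ring)

theorem single_eq_diagonal (k : Fin 3) :
    Matrix.single k k (1 : ℂ) = Matrix.diagonal (Pi.single k (1 : ℂ)) :=
  (Matrix.diagonal_single k 1).symm

/-- Only the power `z⁻¹` survives in the component along `dz ∧ duₖ`. -/
theorem commutator_zero_succ {u : Fin 3 → ℂ} (hu : ∀ i j, i ≠ j → u i - u j ≠ 0) {z : ℂ}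
    (hz : z ≠ 0) (A : Mat3) (k : Fin 3) :
    (Matrix.diagonal u + z⁻¹ • A) * (z • Matrix.single k k (1 : ℂ) + Vk k u A)
      - (z • Matrix.single k k (1 : ℂ) + Vk k u A) * (Matrix.diagonal u + z⁻¹ • A)
      = z⁻¹ • (A * Vk k u A - Vk k u A * A) := by
  have h := offDiagQuotient_commutator_self hu (Pi.single k 1) A
  have hd : Matrix.diagonal u * Matrix.diagonal (Pi.single k (1 : ℂ))
      = Matrix.diagonal (Pi.single k (1 : ℂ)) * Matrix.diagonal u := by
    simp [Matrix.diagonal_mul_diagonal, mul_comm]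
  rw [Vk_eq_offDiagQuotient, single_eq_diagonal]
  generalize offDiagQuotient (Pi.single k 1) u A = W at *
  generalize (Matrix.diagonal (Pi.single k (1 : ℂ)) : Mat3) = E at *
  simp only [Matrix.add_mul, Matrix.mul_add, Matrix.smul_mul, Matrix.mul_smul, smul_sub,
    smul_add, smul_smul, mul_inv_cancel₀ hz, inv_mul_cancel₀ hz, one_smul, hd]
  rw [sub_eq_iff_eq_add] at h
  rw [h]
  abel

/-- Only the power `z⁰` survives in the component along `duₖ ∧ duₘ`. -/
theorem commutator_succ_succ (u : Fin 3 → ℂ) (z : ℂ) (A : Mat3) (k m : Fin 3) :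
    (z • Matrix.single k k (1 : ℂ) + Vk k u A) * (z • Matrix.single m m (1 : ℂ) + Vk m u A)
      - (z • Matrix.single m m (1 : ℂ) + Vk m u A) * (z • Matrix.single k k (1 : ℂ) + Vk k u A)
      = Vk k u A * Vk m u A - Vk m u A * Vk k u A := by
  have h := offDiagQuotient_commutator_diagonal (Pi.single k 1) (Pi.single m 1) u A
  have hd : (Matrix.diagonal (Pi.single m (1 : ℂ)) * Matrix.diagonal (Pi.single k (1 : ℂ)) : Mat3)
      = Matrix.diagonal (Pi.single k (1 : ℂ)) * Matrix.diagonal (Pi.single m (1 : ℂ)) := by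
    simp [Matrix.diagonal_mul_diagonal, mul_comm]
  simp only [Vk_eq_offDiagQuotient, single_eq_diagonal]
  generalize offDiagQuotient (Pi.single k 1) u A = W at *
  generalize offDiagQuotient (Pi.single m 1) u A = W' at *
  generalize (Matrix.diagonal (Pi.single k (1 : ℂ)) : Mat3) = E at *
  generalize (Matrix.diagonal (Pi.single m (1 : ℂ)) : Mat3) = E' at *
  simp only [Matrix.add_mul, Matrix.mul_add, Matrix.smul_mul, Matrix.mul_smul, hd]
  rw [sub_eq_iff_eq_add] at h
  rw [h]
  simp only [smul_add, smul_sub]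
  abel

section Derivatives

variable {𝔻 : Set (Fin 3 → ℂ)} {V : (Fin 3 → ℂ) → Mat3}

theorem HolomorphicOn.hasFDerivAt (hV : HolomorphicOn 𝔻 V) (ho : IsOpen 𝔻) {u : Fin 3 → ℂ}
    (hu : u ∈ 𝔻) (i j : Fin 3) :
    HasFDerivAt (fun w => V w i j) (fderiv ℂ (fun w => V w i j) u) u :=
  ((hV i j).differentiableAt (ho.mem_nhds hu)).hasFDerivAt

/-- `Fin.tail` as a continuous linear map. -/
noncomputable def tailCLM : (Fin 4 → ℂ) →L[ℂ] (Fin 3 → ℂ) :=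
  ContinuousLinearMap.pi fun i => ContinuousLinearMap.proj i.succ

theorem tailCLM_single_succ (k : Fin 3) :
    tailCLM (Pi.single k.succ 1) = Pi.single k 1 := by
  ext i
  simp [tailCLM, Pi.single_apply]

theorem tailCLM_single_zero : tailCLM (Pi.single 0 1) = 0 := by
  ext i
  simp [tailCLM, Fin.succ_ne_zero]

theorem hasFDerivAt_comp_tail {g : (Fin 3 → ℂ) → ℂ} {g' : (Fin 3 → ℂ) →L[ℂ] ℂ} {p : Fin 4 → ℂ}
    (hg : HasFDerivAt g g' (Fin.tail p)) :
    HasFDerivAt (fun q : Fin 4 → ℂ => g (Fin.tail q)) (g'.comp tailCLM) p :=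
  HasFDerivAt.comp (f := fun q : Fin 4 → ℂ => tailCLM q) p hg tailCLM.hasFDerivAt

theorem hasFDerivAt_coord {n : ℕ} (i : Fin n) (p : Fin n → ℂ) :
    HasFDerivAt (fun q : Fin n → ℂ => q i) (ContinuousLinearMap.proj (R := ℂ) i) p :=
  (ContinuousLinearMap.proj (R := ℂ) (φ := fun _ : Fin n => ℂ) i).hasFDerivAt

theorem fderiv_pfaffianForm_zero (hV : HolomorphicOn 𝔻 V) (ho : IsOpen 𝔻) {p : Fin 4 → ℂ}
    (hz : p 0 ≠ 0) (hp : Fin.tail p ∈ 𝔻) (k i j : Fin 3) :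
    fderiv ℂ (fun q => pfaffianForm V 0 q i j) p (Pi.single k.succ 1)
      = Matrix.single k k (1 : ℂ) i j
        + (p 0)⁻¹ * fderiv ℂ (fun w => V w i j) (Fin.tail p) (Pi.single k 1) := by
  have h1 : HasFDerivAt (fun q : Fin 4 → ℂ => (Matrix.diagonal (Fin.tail q) : Mat3) i j)
      ((if i = j then ContinuousLinearMap.proj (R := ℂ) i else 0 :
        (Fin 3 → ℂ) →L[ℂ] ℂ).comp tailCLM) p := by
    apply hasFDerivAt_comp_tail (g := fun w => (Matrix.diagonal w : Mat3) i j)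
    by_cases h : i = j
    · subst h
      simpa using hasFDerivAt_coord i (Fin.tail p)
    · simpa [h] using hasFDerivAt_const (0 : ℂ) (Fin.tail p)
  have h2 := hasFDerivAt_comp_tail (hV.hasFDerivAt ho hp i j)
  have h3 : HasFDerivAt (fun q : Fin 4 → ℂ => (q 0)⁻¹)
      ((-(p 0 ^ 2)⁻¹) • ContinuousLinearMap.proj (R := ℂ) (φ := fun _ : Fin 4 => ℂ) 0) p :=
    (hasDerivAt_inv hz).comp_hasFDerivAt p (hasFDerivAt_coord 0 p)
  have h4 := h1.add (h3.mul h2)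
  have e : (fun q => pfaffianForm V 0 q i j) = (fun q : Fin 4 → ℂ =>
      (Matrix.diagonal (Fin.tail q) : Mat3) i j) + (fun q : Fin 4 → ℂ => (q 0)⁻¹) * fun q =>
        V (Fin.tail q) i j := rfl
  rw [e, h4.fderiv]
  simp only [add_apply, smul_apply,
    ContinuousLinearMap.comp_apply, tailCLM_single_succ, ContinuousLinearMap.proj_apply]
  by_cases h : i = j
  · subst h
    simp [Matrix.single_apply, Pi.single_apply, eq_comm]
  · have : ¬ (k = i ∧ k = j) := fun hh => h (hh.1.symm.trans hh.2)
    simp [h, this]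

theorem hasFDerivAt_offDiagQuotient (hV : HolomorphicOn 𝔻 V) (ho : IsOpen 𝔻)
    {u : Fin 3 → ℂ} (hu : u ∈ 𝔻) (e : Fin 3 → ℂ) {i j : Fin 3} (hij : u i - u j ≠ 0) :
    HasFDerivAt (fun w => V w i j * (e i - e j) / (w i - w j))
      (((e i - e j) / (u i - u j)) • fderiv ℂ (fun w => V w i j) u
        - (V u i j * (e i - e j) / (u i - u j) ^ 2) •
          (ContinuousLinearMap.proj (R := ℂ) (φ := fun _ => ℂ) i
          - ContinuousLinearMap.proj (R := ℂ) (φ := fun _ => ℂ) j)) u := by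
  have h1 := (hV.hasFDerivAt ho hu i j).mul_const (e i - e j)
  have h2 := (hasFDerivAt_coord i u).sub (hasFDerivAt_coord j u)
  have h3 : HasFDerivAt (fun w : Fin 3 → ℂ => (w i - w j)⁻¹) _ u :=
    (hasDerivAt_inv hij).comp_hasFDerivAt u h2
  refine (h1.mul h3).congr_fderiv ?_
  ext v
  simp
  field_simp
  ring

theorem fderiv_pfaffianForm_succ (hV : HolomorphicOn 𝔻 V) (ho : IsOpen 𝔻)
    (hd : Disjoint 𝔻 coalescenceLocus) {p : Fin 4 → ℂ} (hp : Fin.tail p ∈ 𝔻) (k i j : Fin 3)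
    (v : Fin 4 → ℂ) :
    fderiv ℂ (fun q => pfaffianForm V k.succ q i j) p v
      = v 0 * Matrix.single k k (1 : ℂ) i j + if i = j then 0 else
        (Pi.single (M := fun _ => ℂ) k 1 i - Pi.single (M := fun _ => ℂ) k 1 j)
          / (Fin.tail p i - Fin.tail p j)
          * fderiv ℂ (fun w => V w i j) (Fin.tail p) (tailCLM v)
        - V (Fin.tail p) i j *
          (Pi.single (M := fun _ => ℂ) k 1 i - Pi.single (M := fun _ => ℂ) k 1 j)
          / (Fin.tail p i - Fin.tail p j) ^ 2 * (tailCLM v i - tailCLM v j) := by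
  have h1 : HasFDerivAt (fun q : Fin 4 → ℂ => q 0 * Matrix.single k k (1 : ℂ) i j)
      (Matrix.single k k (1 : ℂ) i j • ContinuousLinearMap.proj (R := ℂ) (φ := fun _ => ℂ) 0) p :=
    (hasFDerivAt_coord 0 p).mul_const _
  have e : (fun q => pfaffianForm V k.succ q i j) = (fun q : Fin 4 → ℂ =>
      q 0 * Matrix.single k k (1 : ℂ) i j) + fun q : Fin 4 → ℂ =>
        offDiagQuotient (Pi.single k 1) (Fin.tail q) (V (Fin.tail q)) i j := by
    ext q
    rw [Pi.add_apply, ← Vk_eq_offDiagQuotient]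
    rfl
  rw [e]
  split_ifs with h
  · subst h
    have e2 : (fun q : Fin 4 → ℂ =>
        offDiagQuotient (Pi.single k 1) (Fin.tail q) (V (Fin.tail q)) i i) = fun _ => 0 := by
      ext q
      simp [offDiagQuotient]
    rw [e2, (h1.add (hasFDerivAt_const (0 : ℂ) p)).fderiv]
    simp [mul_comm]
  · have e2 : (fun q : Fin 4 → ℂ =>
        offDiagQuotient (Pi.single k 1) (Fin.tail q) (V (Fin.tail q)) i j) = fun q =>
        (fun w => V w i j * (Pi.single (M := fun _ => ℂ) k 1 i - Pi.single (M := fun _ => ℂ) k 1 j)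
          / (w i - w j)) (Fin.tail q) := by
      ext q
      simp [offDiagQuotient, h]
    have h2 := hasFDerivAt_comp_tail (hasFDerivAt_offDiagQuotient hV ho hp (Pi.single k 1)
      (ne_of_disjoint hd hp h))
    rw [e2, (h1.add h2).fderiv]
    simp [mul_comm]

theorem frobeniusIntegrable_iff (hV : HolomorphicOn 𝔻 V) (ho : IsOpen 𝔻)
    (hd : Disjoint 𝔻 coalescenceLocus) :
    FrobeniusIntegrable (pfaffianForm V) {p | p 0 ≠ 0 ∧ Fin.tail p ∈ 𝔻} ↔ DeformationEq 𝔻 V := by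
  have hz : ∀ p : Fin 4 → ℂ, p 0 ≠ 0 → Fin.tail p ∈ 𝔻 → ∀ k i j : Fin 3,
      fderiv ℂ (fun q => pfaffianForm V k.succ q i j) p (Pi.single 0 1)
        - fderiv ℂ (fun q => pfaffianForm V 0 q i j) p (Pi.single k.succ 1)
      = -((p 0)⁻¹ * fderiv ℂ (fun w => V w i j) (Fin.tail p) (Pi.single k 1)) := by
    intro p h0 hp k i j
    rw [fderiv_pfaffianForm_zero hV ho h0 hp, fderiv_pfaffianForm_succ hV ho hd hp,
      tailCLM_single_zero]
    simp
  have hc : ∀ p : Fin 4 → ℂ, p 0 ≠ 0 → Fin.tail p ∈ 𝔻 → ∀ k i j : Fin 3,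
      (pfaffianForm V 0 p * pfaffianForm V k.succ p
        - pfaffianForm V k.succ p * pfaffianForm V 0 p) i j
      = -((p 0)⁻¹ * (Vk k (Fin.tail p) (V (Fin.tail p)) * V (Fin.tail p)
        - V (Fin.tail p) * Vk k (Fin.tail p) (V (Fin.tail p))) i j) := by
    intro p h0 hp k i j
    have := congrFun (congrFun (commutator_zero_succ (fun i j => ne_of_disjoint hd hp (i := i)
      (j := j)) h0 (V (Fin.tail p)) k) i) j
    refine this.trans ?_
    simp only [Matrix.smul_apply, Matrix.sub_apply, smul_eq_mul]
    ring
  constructor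
  · intro h u hu k i j
    have hp : Fin.tail (Fin.cons (1 : ℂ) u : Fin 4 → ℂ) = u := Fin.tail_cons _ _
    have h0 : (Fin.cons (1 : ℂ) u : Fin 4 → ℂ) 0 = 1 := rfl
    have := h (Fin.cons (1 : ℂ) u) ⟨by rw [h0]; exact one_ne_zero, by rw [hp]; exact hu⟩ 0
      k.succ i j
    rw [hz _ (by rw [h0]; exact one_ne_zero) (by rw [hp]; exact hu),
      hc _ (by rw [h0]; exact one_ne_zero) (by rw [hp]; exact hu), hp, h0] at this
    simpa only [inv_one, one_mul, neg_inj] using this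
  · rintro h p ⟨h0, hp⟩ a b i j
    have zs : ∀ k : Fin 3, fderiv ℂ (fun q => pfaffianForm V k.succ q i j) p (Pi.single 0 1)
        - fderiv ℂ (fun q => pfaffianForm V 0 q i j) p (Pi.single k.succ 1)
      = (pfaffianForm V 0 p * pfaffianForm V k.succ p
        - pfaffianForm V k.succ p * pfaffianForm V 0 p) i j := by
      intro k
      rw [hz p h0 hp, hc p h0 hp, h _ hp]
    refine Fin.cases ?_ (fun k => ?_) a <;> refine Fin.cases ?_ (fun m => ?_) b
    · simp
    · exact zs m
    · rw [← neg_sub, zs k, ← Matrix.neg_apply, neg_sub]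
    · have hne : ∀ i j, i ≠ j → Fin.tail p i - Fin.tail p j ≠ 0 :=
        fun i j hij => ne_of_disjoint hd hp hij
      have hC := congrFun (congrFun
        (commutator_succ_succ (Fin.tail p) (p 0) (V (Fin.tail p)) k m) i) j
      refine Eq.trans ?_ hC.symm
      rw [fderiv_pfaffianForm_succ hV ho hd hp, fderiv_pfaffianForm_succ hV ho hd hp,
        tailCLM_single_succ, tailCLM_single_succ, h _ hp, h _ hp]
      simp only [Vk_eq_offDiagQuotient]
      by_cases hij : i = j
      · subst hij
        rw [offDiagQuotient_commutator_diag]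
        simp
      · rw [← offDiagQuotient_commutator hne _ _ _ hij]
        simp only [if_neg hij, Pi.single_eq_of_ne (Fin.succ_ne_zero _).symm]
        ring

end Derivatives

/-! ### Conjugation by `s^Θ` -/

theorem powConj_apply (θ : Fin 3 → ℂ) (L : ℂ) (A : Mat3) (i j : Fin 3) :
    powConj θ L A i j = exp (θ i * L) * A i j * exp (-(θ j * L)) := by
  simp [powConj, Matrix.diagonal_mul, Matrix.mul_diagonal]

theorem diagonal_exp_mul (θ : Fin 3 → ℂ) (L : ℂ) :
    (Matrix.diagonal (fun i => exp (-(θ i * L))) * Matrix.diagonal fun i => exp (θ i * L) : Mat3)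
      = 1 := by
  rw [Matrix.diagonal_mul_diagonal, ← Matrix.diagonal_one]
  congr 1
  ext i
  rw [← exp_add, neg_add_cancel, exp_zero]

theorem powConj_neg_powConj (L : ℂ) (A : Mat3) : powConj θ (-L) (powConj θ L A) = A := by
  ext i j
  rw [powConj_apply, powConj_apply]
  have h1 : exp (θ i * -L) * exp (θ i * L) = 1 := by
    rw [← exp_add]; ring_nf; exact exp_zero
  have h2 : exp (-(θ j * L)) * exp (-(θ j * -L)) = 1 := by
    rw [← exp_add]; ring_nf; exact exp_zero
  linear_combination A i j * exp (-(θ j * L)) * exp (-(θ j * -L)) * h1 + A i j * h2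

theorem powConj_powConj_neg (L : ℂ) (A : Mat3) : powConj θ L (powConj θ (-L) A) = A := by
  simpa using powConj_neg_powConj (θ := θ) (-L) A

theorem powConj_mul (L : ℂ) (A B : Mat3) :
    powConj θ L (A * B) = powConj θ L A * powConj θ L B := by
  have h := diagonal_exp_mul θ L
  simp only [powConj]
  generalize (Matrix.diagonal (fun i => exp (-(θ i * L))) : Mat3) = E' at *
  generalize (Matrix.diagonal (fun i => exp (θ i * L)) : Mat3) = E at *
  calc E * (A * B) * E' = E * A * 1 * (B * E') := by simp only [Matrix.mul_assoc, Matrix.one_mul]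
    _ = E * A * E' * (E * B * E') := by rw [← h]; simp only [Matrix.mul_assoc]

theorem Constrained.powConj {A : Mat3} (h : Constrained θ θinf A) (L : ℂ) :
    Constrained θ θinf (powConj θ L A) := by
  refine ⟨fun i => ?_, ?_⟩
  · rw [powConj_apply, h.1 i]
    have : exp (θ i * L) * exp (-(θ i * L)) = 1 := by rw [← exp_add, add_neg_cancel, exp_zero]
    linear_combination -θ i * this
  · rw [← h.2, PainleveSix.powConj, Matrix.charpoly_mul_comm, ← Matrix.mul_assoc, diagonal_exp_mul,
      Matrix.one_mul]

theorem Nondegenerate.powConj {A : Mat3} {u : Fin 3 → ℂ} (h : Nondegenerate θ θinf u A) (L : ℂ) :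
    Nondegenerate θ θinf u (powConj θ L A) := by
  obtain ⟨l, r, hl, hr, hlr, hs⟩ := h
  have e : ∀ k, l k * exp (-(θ k * L)) * (exp (θ k * L) * r k) = l k * r k := by
    intro k
    have : exp (θ k * L) * exp (-(θ k * L)) = 1 := by rw [← exp_add, add_neg_cancel, exp_zero]
    linear_combination l k * r k * this
  refine ⟨fun k => l k * exp (-(θ k * L)), fun k => exp (θ k * L) * r k, ?_, ?_,
    fun k => by rw [e]; exact hlr k, by simpa only [e] using hs⟩
  · rw [vecMul_eq_smul_iff] at hl ⊢
    intro j
    have h0 : ∀ k, exp (θ k * L) * exp (-(θ k * L)) = 1 := fun k => by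
      rw [← exp_add, add_neg_cancel, exp_zero]
    simp only [powConj_apply]
    linear_combination exp (-(θ j * L)) * (hl j + l 0 * A 0 j * h0 0 + l 1 * A 1 j * h0 1
      + l 2 * A 2 j * h0 2)
  · rw [mulVec_eq_smul_iff] at hr ⊢
    intro j
    have h0 : ∀ k, exp (θ k * L) * exp (-(θ k * L)) = 1 := fun k => by
      rw [← exp_add, add_neg_cancel, exp_zero]
    simp only [powConj_apply]
    linear_combination exp (θ j * L) * (hr j + A j 0 * r 0 * h0 0 + A j 1 * r 1 * h0 1
      + A j 2 * r 2 * h0 2)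

/-- Nondegeneracy is invariant under affine changes of `u`, because `∑ₖ lₖ rₖ = 0`. -/
theorem nondegenerate_iff_xOf (hinf : θinf ≠ 0) {u : Fin 3 → ℂ} (hu : u 2 - u 0 ≠ 0) (A : Mat3) :
    Nondegenerate θ θinf u A ↔ Nondegenerate θ θinf ![0, xOf u, 1] A := by
  have key : ∀ l r : Fin 3 → ℂ, Matrix.vecMul l A = mu1 θ θinf • l →
      Matrix.mulVec A r = mu3 θ θinf • r →
      ∑ k, u k * (l k * r k) = (u 2 - u 0) * ∑ k, ![0, xOf u, 1] k * (l k * r k) := by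
    intro l r hl hr
    have h := sum_mul_eq_zero_of_eigenvectors hl hr (mu1_ne_mu3 hinf)
    have hx : xOf u * (u 2 - u 0) = u 1 - u 0 := by simp only [xOf]; field_simp
    simp [Fin.sum_univ_three]
    linear_combination u 0 * h - l 1 * r 1 * hx
  constructor
  · rintro ⟨l, r, hl, hr, hlr, hs⟩
    rw [key l r hl hr] at hs
    exact ⟨l, r, hl, hr, hlr, right_ne_zero_of_mul hs⟩
  · rintro ⟨l, r, hl, hr, hlr, hs⟩
    exact ⟨l, r, hl, hr, hlr, by rw [key l r hl hr]; exact mul_ne_zero hu hs⟩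

/-! ### Functions of `x = (u₂ - u₁) / (u₃ - u₁)` -/

/-- The derivative of `xOf` at `u`. -/
noncomputable def xOfDeriv (u : Fin 3 → ℂ) : (Fin 3 → ℂ) →L[ℂ] ℂ :=
  (u 2 - u 0)⁻¹ • (ContinuousLinearMap.proj (R := ℂ) (φ := fun _ => ℂ) 1
      - ContinuousLinearMap.proj (R := ℂ) (φ := fun _ => ℂ) 0)
    - ((u 1 - u 0) / (u 2 - u 0) ^ 2) • (ContinuousLinearMap.proj (R := ℂ) (φ := fun _ => ℂ) 2
      - ContinuousLinearMap.proj (R := ℂ) (φ := fun _ => ℂ) 0)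

theorem xOfDeriv_apply (u v : Fin 3 → ℂ) :
    xOfDeriv u v = (u 2 - u 0)⁻¹ * (v 1 - v 0)
      - (u 1 - u 0) / (u 2 - u 0) ^ 2 * (v 2 - v 0) := by
  simp [xOfDeriv]

theorem hasFDerivAt_xOf {u : Fin 3 → ℂ} (hu : u 2 - u 0 ≠ 0) : HasFDerivAt xOf (xOfDeriv u) u := by
  have h1 := (hasFDerivAt_coord 1 u).sub (hasFDerivAt_coord 0 u)
  have h2 := (hasFDerivAt_coord 2 u).sub (hasFDerivAt_coord 0 u)
  have h3 : HasFDerivAt (fun w : Fin 3 → ℂ => (w 2 - w 0)⁻¹) _ u :=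
    (hasDerivAt_inv hu).comp_hasFDerivAt u h2
  refine (h1.mul h3).congr_fderiv ?_
  ext v
  simp [xOfDeriv]
  ring

/-- The points near `u` with the first and third coordinates of `u` form a section of `xOf`. -/
noncomputable def xSection (u : Fin 3 → ℂ) (t : ℂ) : Fin 3 → ℂ :=
  ![u 0, u 0 + t * (u 2 - u 0), u 2]

theorem xOf_xSection {u : Fin 3 → ℂ} (hu : u 2 - u 0 ≠ 0) (t : ℂ) : xOf (xSection u t) = t := by
  simp [xOf, xSection]
  field_simp

theorem xSection_xOf {u : Fin 3 → ℂ} (hu : u 2 - u 0 ≠ 0) : xSection u (xOf u) = u := by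
  ext i
  fin_cases i <;> simp [xOf, xSection]
  field_simp
  ring

theorem hasDerivAt_xSection (u : Fin 3 → ℂ) (t : ℂ) :
    HasDerivAt (xSection u) ![0, u 2 - u 0, 0] t := by
  rw [hasDerivAt_pi]
  intro i
  fin_cases i
  · exact hasDerivAt_const t (u 0)
  · simpa [xSection] using ((hasDerivAt_id t).mul_const (u 2 - u 0)).const_add (u 0)
  · exact hasDerivAt_const t (u 2)

section Fibres

variable {𝔻 : Set (Fin 3 → ℂ)}

theorem eventually_xSection_mem (ho : IsOpen 𝔻) {u : Fin 3 → ℂ} (hu : u ∈ 𝔻)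
    (h20 : u 2 - u 0 ≠ 0) : ∀ᶠ t in nhds (xOf u), xSection u t ∈ 𝔻 := by
  apply (hasDerivAt_xSection u (xOf u)).continuousAt
  rw [xSection_xOf h20]
  exact ho.mem_nhds hu

theorem isOpen_image_xOf (ho : IsOpen 𝔻) (hd : Disjoint 𝔻 coalescenceLocus) :
    IsOpen (xOf '' 𝔻) := by
  rw [isOpen_iff_mem_nhds]
  rintro _ ⟨u, hu, rfl⟩
  have h20 := ne_of_disjoint hd hu (i := 2) (j := 0) (by decide)
  filter_upwards [eventually_xSection_mem ho hu h20] with t ht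
  exact ⟨_, ht, xOf_xSection h20 t⟩

theorem image_xOf_ne (hd : Disjoint 𝔻 coalescenceLocus) :
    ∀ x ∈ xOf '' 𝔻, x ≠ 0 ∧ x ≠ 1 := by
  rintro _ ⟨u, hu, rfl⟩
  have h20 := ne_of_disjoint hd hu (i := 2) (j := 0) (by decide)
  have h10 := ne_of_disjoint hd hu (i := 1) (j := 0) (by decide)
  have h12 := ne_of_disjoint hd hu (i := 1) (j := 2) (by decide)
  refine ⟨div_ne_zero h10 h20, fun h => h12 ?_⟩
  rw [xOf, div_eq_one_iff_eq h20] at h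
  linear_combination h

/-- A function whose differential is a multiple of `dx` is constant on the connected fibres of
`x`. -/
theorem eq_of_xOf_eq (ho : IsOpen 𝔻) (hd : Disjoint 𝔻 coalescenceLocus)
    (hfib : ∀ c : ℂ, IsPreconnected {u | u ∈ 𝔻 ∧ xOf u = c}) {f g : (Fin 3 → ℂ) → ℂ}
    (hf : ∀ u ∈ 𝔻, HasFDerivAt f (g u • xOfDeriv u) u) {u w : Fin 3 → ℂ} (hu : u ∈ 𝔻)
    (hw : w ∈ 𝔻) (h : xOf u = xOf w) : f u = f w := by
  set c := xOf w with hc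
  -- the plane `{x = c}` with the coordinates `(u₁, u₃ - u₁)`
  let P0 : ℂ × ℂ →L[ℂ] ℂ := ContinuousLinearMap.fst ℂ ℂ ℂ
  let P1 : ℂ × ℂ →L[ℂ] ℂ := ContinuousLinearMap.snd ℂ ℂ ℂ
  let φ : ℂ × ℂ →L[ℂ] (Fin 3 → ℂ) := ContinuousLinearMap.pi ![P0, P0 + c • P1, P0 + P1]
  let ψ : (Fin 3 → ℂ) → ℂ × ℂ := fun v => (v 0, v 2 - v 0)
  have hφ : ∀ q : ℂ × ℂ, φ q = ![q.1, q.1 + c * q.2, q.1 + q.2] := by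
    intro q
    ext i
    fin_cases i <;> simp [φ, P0, P1]
  have hφψ : ∀ v ∈ 𝔻, xOf v = c → φ (ψ v) = v := by
    intro v hv hvc
    have h20 := ne_of_disjoint hd hv (i := 2) (j := 0) (by decide)
    have : c * (v 2 - v 0) = v 1 - v 0 := by rw [← hvc, xOf]; field_simp
    rw [hφ]
    ext i
    fin_cases i <;> simp [ψ, this]
  have hT : φ ⁻¹' 𝔻 = ψ '' {v | v ∈ 𝔻 ∧ xOf v = c} := by
    ext q
    constructor
    · intro hq
      have h20 := ne_of_disjoint hd hq (i := 2) (j := 0) (by decide)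
      have hq2 : q.2 ≠ 0 := by
        rw [hφ] at h20; simpa using h20
      refine ⟨φ q, ⟨hq, ?_⟩, ?_⟩
      · rw [hφ]; simp [xOf, hq2]
      · rw [hφ]; simp [ψ]
    · rintro ⟨v, ⟨hv, hvc⟩, rfl⟩
      change φ (ψ v) ∈ 𝔻
      rw [hφψ v hv hvc]
      exact hv
  have hTo : IsOpen (φ ⁻¹' 𝔻) := ho.preimage φ.continuous
  have hTc : IsPreconnected (φ ⁻¹' 𝔻) := by
    rw [hT]
    refine (hfib c).image ψ (Continuous.continuousOn ?_)
    exact (continuous_apply 0).prodMk ((continuous_apply 2).sub (continuous_apply 0))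
  have hder : ∀ q ∈ φ ⁻¹' 𝔻, HasFDerivAt (fun q => f (φ q)) (0 : ℂ × ℂ →L[ℂ] ℂ) q := by
    intro q hq
    refine ((hf (φ q) hq).comp q φ.hasFDerivAt).congr_fderiv ?_
    apply ContinuousLinearMap.ext
    intro v
    have h20 := ne_of_disjoint hd hq (i := 2) (j := 0) (by decide)
    have hq2 : q.2 ≠ 0 := by
      rw [hφ] at h20; simpa using h20
    rw [ContinuousLinearMap.comp_apply, smul_apply, xOfDeriv_apply, hφ, hφ]
    simp
    right
    field_simp
    ring
  have := hTo.is_const_of_fderiv_eq_zero hTc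
    (fun q hq => (hder q hq).differentiableAt.differentiableWithinAt)
    (fun q hq => (hder q hq).fderiv) (x := ψ u) (y := ψ w)
    (by rw [hT]; exact ⟨u, ⟨hu, h⟩, rfl⟩) (by rw [hT]; exact ⟨w, ⟨hw, rfl⟩, rfl⟩)
  rwa [hφψ u hu h, hφψ w hw rfl] at this

/-- A function whose differential is `g dx` is a function `G` of `x`, with `G' = g`. -/
theorem exists_hasDerivAt_of_hasFDerivAt (ho : IsOpen 𝔻) (hd : Disjoint 𝔻 coalescenceLocus)
    (hfib : ∀ c : ℂ, IsPreconnected {u | u ∈ 𝔻 ∧ xOf u = c}) {f g : (Fin 3 → ℂ) → ℂ}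
    (hf : ∀ u ∈ 𝔻, HasFDerivAt f (g u • xOfDeriv u) u) :
    ∃ G : ℂ → ℂ, ∀ u ∈ 𝔻, G (xOf u) = f u ∧ HasDerivAt G (g u) (xOf u) := by
  have ex : ∀ c, ∃ a, ∀ u ∈ 𝔻, xOf u = c → f u = a := by
    intro c
    by_cases h : ∃ w ∈ 𝔻, xOf w = c
    · obtain ⟨w, hw, hc⟩ := h
      exact ⟨f w, fun u hu huc => eq_of_xOf_eq ho hd hfib hf hu hw (huc.trans hc.symm)⟩
    · exact ⟨0, fun u hu huc => absurd ⟨u, hu, huc⟩ h⟩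
  choose G hG using ex
  refine ⟨G, fun u hu => ⟨(hG _ u hu rfl).symm, ?_⟩⟩
  have h20 := ne_of_disjoint hd hu (i := 2) (j := 0) (by decide)
  have h1 : HasFDerivAt f (g u • xOfDeriv u) (xSection u (xOf u)) := by
    rw [xSection_xOf h20]; exact hf u hu
  have h2 := h1.comp_hasDerivAt (xOf u) (hasDerivAt_xSection u (xOf u))
  have e : G =ᶠ[nhds (xOf u)] f ∘ xSection u := by
    filter_upwards [eventually_xSection_mem ho hu h20] with t ht
    exact (hG t _ ht (xOf_xSection h20 t)).symm
  refine (h2.congr_of_eventuallyEq e).congr_deriv ?_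
  rw [smul_apply, xOfDeriv_apply]
  simp [h20]

end Fibres

/-! ### The deformation equations and the reduced system -/

theorem offDiagQuotient_powConj (e u : Fin 3 → ℂ) (L : ℂ) (A : Mat3) :
    offDiagQuotient e u (powConj θ L A) = powConj θ L (offDiagQuotient e u A) := by
  ext i j
  rw [powConj_apply]
  simp only [offDiagQuotient, Matrix.of_apply, powConj_apply]
  split_ifs <;> ring

/-- The decomposition of a direction `v` along `(1, 1, 1)`, the Euler field and `∂₂`. -/
theorem offDiagQuotient_eq {u : Fin 3 → ℂ} (hu : ∀ i j, i ≠ j → u i - u j ≠ 0) (v : Fin 3 → ℂ)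
    {A : Mat3} (hA : ∀ i, A i i = -θ i) :
    offDiagQuotient v u A = ((v 2 - v 0) / (u 2 - u 0)) • (A + Matrix.diagonal θ)
      - xOfDeriv u v • omegaHat (xOf u) A := by
  have h01 := hu 0 1 (by decide)
  have h02 := hu 0 2 (by decide)
  have h12 := hu 1 2 (by decide)
  have h10 := hu 1 0 (by decide)
  have h20 := hu 2 0 (by decide)
  have h21 := hu 2 1 (by decide)
  have e : 1 - xOf u = (u 2 - u 1) / (u 2 - u 0) := by simp only [xOf]; field_simp; ring
  ext i j
  rw [xOfDeriv_apply]
  fin_cases i <;> fin_cases j <;> simp [offDiagQuotient, omegaHat, hA, e] <;>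
    (try simp only [xOf]) <;> (try field_simp) <;> (try ring)

/-- In the direction `v` the deformation flow is the sum of conjugation by `s^Θ`, from the Euler
field, and the flow of the reduced system. -/
theorem offDiagQuotient_commutator_eq {u : Fin 3 → ℂ} (hu : ∀ i j, i ≠ j → u i - u j ≠ 0)
    (v : Fin 3 → ℂ) {A : Mat3} (hA : ∀ i, A i i = -θ i) (i j : Fin 3) :
    (offDiagQuotient v u A * A - A * offDiagQuotient v u A) i j
      = (θ i - θ j) * ((v 2 - v 0) / (u 2 - u 0)) * A i j
        + (A * omegaHat (xOf u) A - omegaHat (xOf u) A * A) i j * xOfDeriv u v := by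
  rw [offDiagQuotient_eq hu v hA]
  simp only [Matrix.sub_mul, Matrix.mul_sub, Matrix.smul_mul, Matrix.mul_smul, Matrix.add_mul,
    Matrix.mul_add, Matrix.sub_apply, Matrix.smul_apply, Matrix.add_apply, Matrix.diagonal_mul,
    Matrix.mul_diagonal, smul_eq_mul]
  ring

theorem offDiagQuotient_eq_sum (v u : Fin 3 → ℂ) (A : Mat3) :
    offDiagQuotient v u A = ∑ k, v k • Vk k u A := by
  ext i j
  simp only [Vk_eq_offDiagQuotient, Matrix.sum_apply, Matrix.smul_apply, offDiagQuotient,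
    Matrix.of_apply, smul_eq_mul]
  split_ifs with h
  · simp
  · have e : ∀ i, v i = ∑ k, v k * Pi.single (M := fun _ => ℂ) k 1 i := by
      intro i
      simp [Pi.single_apply]
    conv_lhs => rw [e i, e j, ← Finset.sum_sub_distrib, Finset.mul_sum, Finset.sum_div]
    exact Finset.sum_congr rfl fun k _ => by ring

/-- The deformation equations in an arbitrary direction `v`. -/
theorem deformationEq_iff {𝔻 : Set (Fin 3 → ℂ)} {V : (Fin 3 → ℂ) → Mat3} :
    DeformationEq 𝔻 V ↔ ∀ u ∈ 𝔻, ∀ v : Fin 3 → ℂ, ∀ i j, fderiv ℂ (fun w => V w i j) u v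
      = (offDiagQuotient v u (V u) * V u - V u * offDiagQuotient v u (V u)) i j := by
  constructor
  · intro h u hu v i j
    have hv : v = ∑ k, v k • (Pi.single k 1 : Fin 3 → ℂ) := by
      ext i
      simp [Finset.sum_apply, Pi.single_apply]
    conv_lhs => rw [hv]
    rw [map_sum, offDiagQuotient_eq_sum, Finset.sum_mul, Finset.mul_sum,
      ← Finset.sum_sub_distrib, Matrix.sum_apply]
    refine Finset.sum_congr rfl fun k _ => ?_
    rw [map_smul, h u hu k i j, Matrix.smul_mul, Matrix.mul_smul, ← smul_sub, Matrix.smul_apply]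
  · intro h u hu k i j
    rw [h u hu, Vk_eq_offDiagQuotient]

section LogBranch

variable {𝔻 : Set (Fin 3 → ℂ)} {L : (Fin 3 → ℂ) → ℂ}

theorem IsLogBranch.fderiv_apply (hL : IsLogBranch 𝔻 L) (ho : IsOpen 𝔻) {u : Fin 3 → ℂ}
    (hu : u ∈ 𝔻) (v : Fin 3 → ℂ) : fderiv ℂ L u v = (v 2 - v 0) / (u 2 - u 0) := by
  have hn : 𝔻 ∈ nhds u := ho.mem_nhds hu
  have h1 := (hL.1.differentiableAt hn).hasFDerivAt.cexp
  have h2 := (hasFDerivAt_coord 2 u).sub (hasFDerivAt_coord 0 u)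
  have h3 := (h2.congr_of_eventuallyEq (Filter.mem_of_superset hn hL.2)).unique h1
  have h4 := congrArg (fun F : (Fin 3 → ℂ) →L[ℂ] ℂ => F v) h3
  simp [hL.2 u hu] at h4
  have h5 : u 2 - u 0 ≠ 0 := by rw [← hL.2 u hu]; exact exp_ne_zero _
  rw [h4]
  field_simp

/-- `d(s^Θ W s^(-Θ)) = s^Θ (dW + [Θ, W] d log s) s^(-Θ)`. -/
theorem hasFDerivAt_powConj (hL : IsLogBranch 𝔻 L) (ho : IsOpen 𝔻) {u : Fin 3 → ℂ} (hu : u ∈ 𝔻)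
    {W : (Fin 3 → ℂ) → Mat3} {W' : (Fin 3 → ℂ) →L[ℂ] ℂ} {i j : Fin 3}
    (hW : HasFDerivAt (fun w => W w i j) W' u) :
    HasFDerivAt (fun w => powConj θ (L w) (W w) i j)
      ((exp (θ i * L u) * exp (-(θ j * L u))) •
        (W' + ((θ i - θ j) * W u i j) • fderiv ℂ L u)) u := by
  have hl := (hL.1.differentiableAt (ho.mem_nhds hu)).hasFDerivAt
  have e : (fun w => powConj θ (L w) (W w) i j)
      = fun w => exp (θ i * L w) * W w i j * exp (-(θ j * L w)) :=
    funext fun w => powConj_apply _ _ _ _ _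
  rw [e]
  refine (((hl.const_mul (θ i)).cexp.mul hW).mul (hl.const_mul (θ j)).neg.cexp).congr_fderiv ?_
  ext v
  simp
  ring

/-- In terms of `W = s^(-Θ) V s^Θ` the deformation equations read `dW = [W, Ŵ] dx`. -/
theorem deformationEq_powConj_iff (ho : IsOpen 𝔻) (hd : Disjoint 𝔻 coalescenceLocus)
    (hL : IsLogBranch 𝔻 L) {V W : (Fin 3 → ℂ) → Mat3} (hW : HolomorphicOn 𝔻 W)
    (hdiag : ∀ u ∈ 𝔻, ∀ i, W u i i = -θ i) (hVW : ∀ u ∈ 𝔻, V u = powConj θ (L u) (W u)) :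
    DeformationEq 𝔻 V ↔ ∀ u ∈ 𝔻, ∀ i j, HasFDerivAt (fun w => W w i j)
      ((W u * omegaHat (xOf u) (W u) - omegaHat (xOf u) (W u) * W u) i j • xOfDeriv u) u := by
  have key : ∀ u ∈ 𝔻, ∀ v i j, (fderiv ℂ (fun w => V w i j) u v
      = (offDiagQuotient v u (V u) * V u - V u * offDiagQuotient v u (V u)) i j) ↔
      fderiv ℂ (fun w => W w i j) u v
        = (W u * omegaHat (xOf u) (W u) - omegaHat (xOf u) (W u) * W u) i j * xOfDeriv u v := by
    intro u hu v i j
    have hn : 𝔻 ∈ nhds u := ho.mem_nhds hu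
    have h1 : fderiv ℂ (fun w => V w i j) u v = exp (θ i * L u) * exp (-(θ j * L u)) *
        (fderiv ℂ (fun w => W w i j) u v
          + (θ i - θ j) * ((v 2 - v 0) / (u 2 - u 0)) * W u i j) := by
      have e : (fun w => V w i j) =ᶠ[nhds u] fun w => powConj θ (L w) (W w) i j :=
        Filter.mem_of_superset hn fun w hw => congrFun (congrFun (hVW w hw) i) j
      rw [e.fderiv_eq, (hasFDerivAt_powConj hL ho hu (hW.hasFDerivAt ho hu i j)).fderiv]
      simp only [smul_apply, add_apply, smul_eq_mul, hL.fderiv_apply ho hu]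
      ring
    have h2 : (offDiagQuotient v u (V u) * V u - V u * offDiagQuotient v u (V u)) i j
        = exp (θ i * L u) * exp (-(θ j * L u)) *
          (offDiagQuotient v u (W u) * W u - W u * offDiagQuotient v u (W u)) i j := by
      rw [hVW u hu, offDiagQuotient_powConj, ← powConj_mul, ← powConj_mul, Matrix.sub_apply,
        powConj_apply, powConj_apply, Matrix.sub_apply]
      ring
    rw [h1, h2, offDiagQuotient_commutator_eq (fun i j hij => ne_of_disjoint hd hu hij) v
      (hdiag u hu), mul_right_inj' (mul_ne_zero (exp_ne_zero _) (exp_ne_zero _)), add_comm,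
      add_right_inj]
  rw [deformationEq_iff]
  constructor
  · intro h u hu i j
    refine (hW.hasFDerivAt ho hu i j).congr_fderiv ?_
    ext1 v
    exact (key u hu v i j).1 (h u hu v i j)
  · intro h u hu v i j
    refine (key u hu v i j).2 ?_
    rw [(h u hu i j).fderiv]
    rfl

theorem HolomorphicOn.powConj (hL : IsLogBranch 𝔻 L) (ho : IsOpen 𝔻) {W V : (Fin 3 → ℂ) → Mat3}
    (hW : HolomorphicOn 𝔻 W) (hVW : ∀ u ∈ 𝔻, V u = powConj θ (L u) (W u)) : HolomorphicOn 𝔻 V := by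
  intro i j u hu
  have h := (hasFDerivAt_powConj (θ := θ) hL ho hu
    (hW.hasFDerivAt ho hu i j)).differentiableAt.differentiableWithinAt (s := 𝔻)
  exact h.congr (fun w hw => congrFun (congrFun (hVW w hw) i) j)
    (congrFun (congrFun (hVW u hu) i) j)

theorem isVSolution_powConj (ho : IsOpen 𝔻) (hd : Disjoint 𝔻 coalescenceLocus)
    (hL : IsLogBranch 𝔻 L) {V : (Fin 3 → ℂ) → Mat3} {Ω : ℂ → Mat3}
    (hΩ : IsOmegaSolution θ θinf (xOf '' 𝔻) Ω)
    (hV : ∀ u ∈ 𝔻, V u = powConj θ (L u) (Ω (xOf u))) : IsVSolution θ θinf 𝔻 V := by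
  have hder : ∀ u ∈ 𝔻, ∀ i j, HasFDerivAt (fun w => Ω (xOf w) i j)
      ((Ω (xOf u) * omegaHat (xOf u) (Ω (xOf u)) - omegaHat (xOf u) (Ω (xOf u)) * Ω (xOf u)) i j
        • xOfDeriv u) u := fun u hu i j =>
    (hΩ.1 (xOf u) ⟨u, hu, rfl⟩ i j).comp_hasFDerivAt u
      (hasFDerivAt_xOf (ne_of_disjoint hd hu (by decide)))
  have hW : HolomorphicOn 𝔻 fun u => Ω (xOf u) :=
    fun i j u hu => (hder u hu i j).differentiableAt.differentiableWithinAt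
  refine ⟨hW.powConj hL ho hV, ?_, fun u hu => ?_⟩
  · exact (deformationEq_powConj_iff ho hd hL hW (fun u hu => (hΩ.2 _ ⟨u, hu, rfl⟩).1) hV).2 hder
  · rw [hV u hu]
    exact (hΩ.2 _ ⟨u, hu, rfl⟩).powConj _

theorem exists_isOmegaSolution (ho : IsOpen 𝔻) (hd : Disjoint 𝔻 coalescenceLocus)
    (hfib : ∀ c : ℂ, IsPreconnected {u | u ∈ 𝔻 ∧ xOf u = c}) (hL : IsLogBranch 𝔻 L)
    {V : (Fin 3 → ℂ) → Mat3} (hV : IsVSolution θ θinf 𝔻 V) :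
    ∃ Ω : ℂ → Mat3, IsOmegaSolution θ θinf (xOf '' 𝔻) Ω ∧
      ∀ u ∈ 𝔻, V u = powConj θ (L u) (Ω (xOf u)) := by
  set W : (Fin 3 → ℂ) → Mat3 := fun u => powConj θ (-(L u)) (V u)
  have hVW : ∀ u ∈ 𝔻, V u = powConj θ (L u) (W u) := fun u _ => (powConj_powConj_neg _ _).symm
  have hWc : ∀ u ∈ 𝔻, Constrained θ θinf (W u) := fun u hu => (hV.2.2 u hu).powConj _
  have hW : HolomorphicOn 𝔻 W := by
    intro i j
    have e : (fun u => W u i j) = fun u => exp (θ i * -(L u)) * V u i j * exp (-(θ j * -(L u))) :=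
      funext fun u => powConj_apply _ _ _ _ _
    rw [e]
    have h1 := hV.1 i j
    have h2 := hL.1
    fun_prop
  have hder := (deformationEq_powConj_iff ho hd hL hW (fun u hu => (hWc u hu).1) hVW).1 hV.2.1
  choose G hG using fun i j => exists_hasDerivAt_of_hasFDerivAt ho hd hfib
    (f := fun u => W u i j) (g := fun u => (W u * omegaHat (xOf u) (W u)
      - omegaHat (xOf u) (W u) * W u) i j) fun u hu => hder u hu i j
  obtain ⟨Ω, hΩ⟩ : ∃ Ω : ℂ → Mat3, ∀ u ∈ 𝔻, Ω (xOf u) = W u ∧ ∀ i j,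
      HasDerivAt (fun t => Ω t i j) ((W u * omegaHat (xOf u) (W u)
        - omegaHat (xOf u) (W u) * W u) i j) (xOf u) := by
    refine ⟨fun x => Matrix.of fun i j => G i j x, fun u hu => ⟨?_, fun i j => (hG i j u hu).2⟩⟩
    ext i j
    exact (hG i j u hu).1
  refine ⟨Ω, ⟨?_, ?_⟩, fun u hu => ?_⟩
  · rintro _ ⟨u, hu, rfl⟩ i j
    rw [(hΩ u hu).1]
    exact (hΩ u hu).2 i j
  · rintro _ ⟨u, hu, rfl⟩
    rw [(hΩ u hu).1]
    exact hWc u hu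
  · rw [(hΩ u hu).1]
    exact hVW u hu

theorem nondegenerate_powConj_iff (hinf : θinf ≠ 0) (hd : Disjoint 𝔻 coalescenceLocus)
    {V : (Fin 3 → ℂ) → Mat3} {Ω : ℂ → Mat3}
    (hV : ∀ u ∈ 𝔻, V u = powConj θ (L u) (Ω (xOf u))) :
    (∀ u ∈ 𝔻, Nondegenerate θ θinf u (V u)) ↔
      ∀ x ∈ xOf '' 𝔻, Nondegenerate θ θinf ![0, x, 1] (Ω x) := by
  constructor
  · rintro h _ ⟨u, hu, rfl⟩
    rw [← nondegenerate_iff_xOf hinf (ne_of_disjoint hd hu (by decide)),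
      ← powConj_neg_powConj (θ := θ) (L u) (Ω (xOf u)), ← hV u hu]
    exact (h u hu).powConj _
  · intro h u hu
    rw [hV u hu]
    exact ((nondegenerate_iff_xOf hinf (ne_of_disjoint hd hu (by decide)) _).2
      (h _ ⟨u, hu, rfl⟩)).powConj _

end LogBranch

/-! ### The nondegenerate locus of a solution -/

/-- The products `lₖ rₖ` for the left eigenvector `leftProj` and the right eigenvector
`rightProj`. -/
noncomputable def residue (θ : Fin 3 → ℂ) (θinf : ℂ) (A : Mat3) (i j k : Fin 3) : ℂ :=
  leftProj θ θinf A j k * rightProj θ θinf A i k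

/-- The product whose nonvanishing expresses nondegeneracy at `(0, x, 1)`. -/
noncomputable def discr (θ : Fin 3 → ℂ) (θinf : ℂ) (i j : Fin 3) (x : ℂ) (A : Mat3) : ℂ :=
  residue θ θinf A i j 0 * residue θ θinf A i j 1 * residue θ θinf A i j 2
    * (x * residue θ θinf A i j 1 + residue θ θinf A i j 2)

theorem nondegenerate_of_discr_ne_zero {A : Mat3} (hA : Constrained θ θinf A) {x : ℂ} {i j : Fin 3}
    (h : discr θ θinf i j x A ≠ 0) : Nondegenerate θ θinf ![0, x, 1] A := by
  have h012 := left_ne_zero_of_mul h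
  have h01 := left_ne_zero_of_mul h012
  refine ⟨leftProj θ θinf A j, rightProj θ θinf A i, hA.vecMul_leftProj j, hA.mulVec_rightProj i,
    fun k => ?_, ?_⟩
  · fin_cases k
    · exact left_ne_zero_of_mul h01
    · exact right_ne_zero_of_mul h01
    · exact right_ne_zero_of_mul h012
  · have := right_ne_zero_of_mul h
    simpa [Fin.sum_univ_three, residue] using this

/-- At a nondegenerate matrix some row `leftProj` and some column `rightProj` are nonzero multiples
of the eigenvectors `l` and `r`. -/
theorem exists_discr_ne_zero (hinf : θinf ≠ 0) (hadd : θinf ≠ ∑ i, θ i) (hsub : θinf ≠ -∑ i, θ i)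
    {A : Mat3} (hA : Constrained θ θinf A) {x : ℂ} (hnd : Nondegenerate θ θinf ![0, x, 1] A) :
    ∃ i j, discr θ θinf i j x A ≠ 0 := by
  obtain ⟨l, r, hl, hr, hlr, hs⟩ := hnd
  have hl2 := left_ne_zero_of_mul (hlr 2)
  have hr2 := right_ne_zero_of_mul (hlr 2)
  obtain ⟨i, hi⟩ := exists_rightProj_ne_zero hinf hsub hr hr2
  obtain ⟨j, hj⟩ := exists_leftProj_ne_zero hinf hadd hl hl2
  have R := eq_smul_of_mulVec_eq_smul hl hr (mu1_ne_mu3 hinf) (mu3_ne_zero hsub)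
    (trace_of_diag hA.1) hlr (hA.mulVec_rightProj i)
  have L := eq_smul_of_vecMul_eq_smul hl hr (mu1_ne_mu3 hinf) (mu1_ne_zero hadd)
    (trace_of_diag hA.1) hlr (hA.vecMul_leftProj j)
  have hc : leftProj θ θinf A j 2 / l 2 * (rightProj θ θinf A i 2 / r 2) ≠ 0 :=
    mul_ne_zero (div_ne_zero hj hl2) (div_ne_zero hi hr2)
  have e : ∀ k, residue θ θinf A i j k
      = leftProj θ θinf A j 2 / l 2 * (rightProj θ θinf A i 2 / r 2) * (l k * r k) := by
    intro k
    rw [residue, L k, R k]; ring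
  refine ⟨i, j, ?_⟩
  have h := fun k => mul_ne_zero hc (hlr k)
  rw [discr, e, e, e]
  refine mul_ne_zero (mul_ne_zero (mul_ne_zero (h 0) (h 1)) (h 2)) ?_
  have hs' : x * (l 1 * r 1) + l 2 * r 2 ≠ 0 := by simpa [Fin.sum_univ_three] using hs
  convert mul_ne_zero hc hs' using 1
  ring

theorem differentiableOn_residue {D : Set ℂ} {Ω : ℂ → Mat3} (hΩ : IsOmegaSolution θ θinf D Ω)
    (i j k : Fin 3) : DifferentiableOn ℂ (fun t => residue θ θinf (Ω t) i j k) D := by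
  intro x hx
  have h := fun i j => (hΩ.1 x hx i j).differentiableAt
  exact ((differentiableAt_leftProj h j k).mul
    (differentiableAt_rightProj h i k)).differentiableWithinAt

theorem differentiableOn_discr {D : Set ℂ} {Ω : ℂ → Mat3} (hΩ : IsOmegaSolution θ θinf D Ω)
    (i j : Fin 3) : DifferentiableOn ℂ (fun t => discr θ θinf i j t (Ω t)) D := by
  have h0 := differentiableOn_residue hΩ i j 0
  have h1 := differentiableOn_residue hΩ i j 1
  have h2 := differentiableOn_residue hΩ i j 2
  simp only [discr]
  fun_prop

theorem isOpen_nondegenerate {D : Set ℂ} (hDo : IsOpen D) (hinf : θinf ≠ 0)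
    (hadd : θinf ≠ ∑ i, θ i) (hsub : θinf ≠ -∑ i, θ i) {Ω : ℂ → Mat3}
    (hΩ : IsOmegaSolution θ θinf D Ω) :
    IsOpen {x | x ∈ D ∧ Nondegenerate θ θinf ![0, x, 1] (Ω x)} := by
  rw [isOpen_iff_mem_nhds]
  rintro x ⟨hx, hnd⟩
  obtain ⟨i, j, hij⟩ := exists_discr_ne_zero hinf hadd hsub (hΩ.2 x hx) hnd
  have hn := hDo.mem_nhds hx
  filter_upwards [hn, ((differentiableOn_discr hΩ i j).differentiableAt
    hn).continuousAt.eventually_ne hij] with t ht h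
  exact ⟨ht, nondegenerate_of_discr_ne_zero (hΩ.2 t ht) h⟩

/-- A solution that is nondegenerate at one point is so off the zeros of a holomorphic function,
and the transcendent is a quotient of holomorphic functions off these zeros. -/
theorem exists_meromorphic_transcendent {D : Set ℂ} (hDo : IsOpen D) (hDc : IsPreconnected D)
    (hD : ∀ x ∈ D, x ≠ 0 ∧ x ≠ 1) (hinf : θinf ≠ 0) (hadd : θinf ≠ ∑ i, θ i)
    (hsub : θinf ≠ -∑ i, θ i) {Ω : ℂ → Mat3} (hΩ : IsOmegaSolution θ θinf D Ω)
    (hex : ∃ x ∈ D, Nondegenerate θ θinf ![0, x, 1] (Ω x)) :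
    ∃ D' : Set ℂ, D' = {x | x ∈ D ∧ Nondegenerate θ θinf ![0, x, 1] (Ω x)} ∧
      IsOpen D' ∧ D' ∈ Filter.codiscreteWithin D ∧
      ∃ y k1 k2 : ℂ → ℂ, MeromorphicOn y D ∧ IsTranscendent θ θinf D' y ∧
        SolvesQuadratures θ D' y k1 k2 ∧
        ∀ x ∈ D', Ω x = explicitOmega θ θinf x (y x) (deriv y x) (k1 x) (k2 x) := by
  obtain ⟨D', hD'⟩ : ∃ D', D' = {x | x ∈ D ∧ Nondegenerate θ θinf ![0, x, 1] (Ω x)} := ⟨_, rfl⟩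
  have hsubs : D' ⊆ D := by rw [hD']; exact fun x hx => hx.1
  have hopen : IsOpen D' := by rw [hD']; exact isOpen_nondegenerate hDo hinf hadd hsub hΩ
  obtain ⟨x0, hx0, hnd0⟩ := hex
  obtain ⟨i, j, hij⟩ := exists_discr_ne_zero hinf hadd hsub (hΩ.2 x0 hx0) hnd0
  have hF : AnalyticOnNhd ℂ (fun t => discr θ θinf i j t (Ω t)) D :=
    (differentiableOn_discr hΩ i j).analyticOnNhd hDo
  have hcod := hF.preimage_zero_mem_codiscreteWithin hij hx0 ⟨⟨x0, hx0⟩, hDc⟩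
  have hcod' := Filter.inter_mem hcod (Filter.self_mem_codiscreteWithin D)
  have hΩ' : IsOmegaSolution θ θinf D' Ω :=
    ⟨fun x hx => hΩ.1 x (hsubs hx), fun x hx => hΩ.2 x (hsubs hx)⟩
  obtain ⟨y, k1, k2, hy, hk, hE⟩ := exists_transcendent_of_isOmegaSolution hopen
    (fun x hx => hD x (hsubs hx)) hinf hadd hsub hΩ' (by rw [hD']; exact fun x hx => hx.2)
  have hmem : ∀ x ∈ D, discr θ θinf i j x (Ω x) ≠ 0 → x ∈ D' := by
    intro x hx h
    rw [hD']
    exact ⟨hx, nondegenerate_of_discr_ne_zero (hΩ.2 x hx) h⟩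
  refine ⟨D', hD', hopen, Filter.mem_of_superset hcod' fun x hx => hmem x hx.2 hx.1, y, k1, k2, ?_,
    hy, hk, hE⟩
  have an := fun k => (differentiableOn_residue hΩ i j k).analyticOnNhd hDo
  have hm : MeromorphicOn (fun t => -(t * residue θ θinf (Ω t) i j 0)
      / (t * residue θ θinf (Ω t) i j 1 + residue θ θinf (Ω t) i j 2)) D := by
    intro x hx
    have a0 := an 0 x hx
    have a1 := an 1 x hx
    have a2 := an 2 x hx
    have ax : AnalyticAt ℂ (fun t : ℂ => t) x := analyticAt_id
    exact (ax.fun_mul a0).fun_neg.meromorphicAt.fun_div ((ax.fun_mul a1).fun_add a2).meromorphicAt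
  refine hm.congr_codiscreteWithin ?_ hDo
  refine Filter.mem_of_superset hcod' ?_
  rintro x ⟨hx, hxD⟩
  have hxD' := hmem x hxD hx
  have had := hk.admissible (fun x hx => hD x (hsubs hx)) hy hxD'
  have hc := hΩ.2 x hxD
  have h2 : residue θ θinf (Ω x) i j 2 ≠ 0 := right_ne_zero_of_mul (left_ne_zero_of_mul hx)
  refine (had.eq_of_eigenvectors (p := deriv y x) hinf hadd hsub ?_ ?_ (left_ne_zero_of_mul h2)
    (right_ne_zero_of_mul h2)).2.2.2.symm
  · rw [← hE x hxD']; exact hc.vecMul_leftProj j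
  · rw [← hE x hxD']; exact hc.mulVec_rightProj i

/-! ### Quadratures and diagonal conjugation -/

theorem diagonal_conj_apply (c1 c2 : ℂ) (A : Mat3) (i j : Fin 3) :
    (Matrix.diagonal ![c1, c2, 1] * A * Matrix.diagonal ![c1⁻¹, c2⁻¹, 1]) i j
      = ![c1, c2, 1] i * A i j * ![c1⁻¹, c2⁻¹, 1] j := by
  rw [Matrix.mul_diagonal, Matrix.diagonal_mul]

theorem explicitOmega_mul (x y p k1 k2 c1 c2 : ℂ) (h1 : c1 ≠ 0) (h2 : c2 ≠ 0) :
    explicitOmega θ θinf x y p (c1 * k1) (c2 * k2)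
      = Matrix.diagonal ![c1, c2, 1] * explicitOmega θ θinf x y p k1 k2
        * Matrix.diagonal ![c1⁻¹, c2⁻¹, 1] := by
  ext i j
  rw [diagonal_conj_apply]
  have e1 : c1 * c1⁻¹ = 1 := mul_inv_cancel₀ h1
  have e2 : c2 * c2⁻¹ = 1 := mul_inv_cancel₀ h2
  fin_cases i <;> fin_cases j <;>
    simp only [explicitOmega, Fin.isValue, Fin.zero_eta, Fin.mk_one, Fin.reduceFinMk,
      Matrix.of_apply, Matrix.cons_val, Matrix.cons_val_zero, Matrix.cons_val_one, div_eq_mul_inv,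
      mul_inv]
  · linear_combination -(-θ 0) * e1
  · ring
  · ring
  · ring
  · linear_combination -(-θ 1) * e2
  · ring
  · ring
  · ring
  · ring

theorem powConj_diagonal_conj (L c1 c2 : ℂ) (A : Mat3) :
    powConj θ L (Matrix.diagonal ![c1, c2, 1] * A * Matrix.diagonal ![c1⁻¹, c2⁻¹, 1])
      = Matrix.diagonal ![c1, c2, 1] * powConj θ L A * Matrix.diagonal ![c1⁻¹, c2⁻¹, 1] := by
  ext i j
  rw [powConj_apply, diagonal_conj_apply, diagonal_conj_apply, powConj_apply]
  ring

/-- Nowhere zero solutions of a scalar linear equation on a connected open set are proportional. -/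
theorem exists_eq_const_mul {D : Set ℂ} (hDo : IsOpen D) (hDc : IsPreconnected D) {a k m : ℂ → ℂ}
    (hk0 : ∀ x ∈ D, k x ≠ 0) (hm0 : ∀ x ∈ D, m x ≠ 0) (hk : ∀ x ∈ D, HasDerivAt k (a x * k x) x)
    (hm : ∀ x ∈ D, HasDerivAt m (a x * m x) x) : ∃ c, c ≠ 0 ∧ ∀ x ∈ D, m x = c * k x := by
  have hd : ∀ x ∈ D, HasDerivAt (fun t => m t / k t) 0 x := fun x hx => by
    refine ((hm x hx).fun_div (hk x hx) (hk0 x hx)).congr_deriv ?_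
    ring
  obtain ⟨c, hc⟩ := hDo.exists_is_const_of_deriv_eq_zero hDc
    (fun x hx => (hd x hx).differentiableAt.differentiableWithinAt) fun x hx => (hd x hx).deriv
  rcases D.eq_empty_or_nonempty with rfl | ⟨x0, hx0⟩
  · exact ⟨1, one_ne_zero, fun x hx => absurd hx (Set.notMem_empty x)⟩
  · refine ⟨c, ?_, fun x hx => ?_⟩
    · rw [← hc x0 hx0]; exact div_ne_zero (hm0 x0 hx0) (hk0 x0 hx0)
    · rw [← hc x hx]; have := hk0 x hx; field_simp

theorem GivenByQuadratures.solvesQuadratures {D : Set ℂ} {y k1 k2 : ℂ → ℂ} (hDo : IsOpen D)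
    (h : GivenByQuadratures θ D y k1 k2) : SolvesQuadratures θ D y k1 k2 := by
  obtain ⟨c1, c2, L1, L2, h1, h2, h⟩ := h
  intro x hx
  have hn := hDo.mem_nhds hx
  obtain ⟨d1, d2, e1, e2⟩ := h x hx
  refine ⟨by rw [e1]; exact mul_ne_zero h1 (exp_ne_zero _),
    by rw [e2]; exact mul_ne_zero h2 (exp_ne_zero _), ?_, ?_⟩
  · refine ((d1.cexp.const_mul c1).congr_of_eventuallyEq
      (Filter.mem_of_superset hn fun t ht => (h t ht).2.2.1)).congr_deriv ?_
    rw [e1]; ring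
  · refine ((d2.cexp.const_mul c2).congr_of_eventuallyEq
      (Filter.mem_of_superset hn fun t ht => (h t ht).2.2.2)).congr_deriv ?_
    rw [e2]; ring

theorem exists_primitives {D : Set ℂ} (hDo : IsOpen D) (hD : ∀ x ∈ D, x ≠ 0 ∧ x ≠ 1)
    (hex : ∀ f : ℂ → ℂ, DifferentiableOn ℂ f D → IsExactOn f D) {y : ℂ → ℂ}
    (hy : IsTranscendent θ θinf D y) :
    ∃ L1 L2 : ℂ → ℂ, ∀ x ∈ D, HasDerivAt L1 (l1 θ x (y x) (deriv y x)) x ∧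
      HasDerivAt L2 (l2 θ x (y x) (deriv y x)) x := by
  have h1 : DifferentiableOn ℂ (fun x => l1 θ x (y x) (deriv y x)) D := by
    intro x hx
    have hn := hDo.mem_nhds hx
    have dy := hy.1.differentiableAt hn
    have dp := (hy.1.deriv hDo).differentiableAt hn
    have a0 := (hD x hx).1
    have a1 := sub_ne_zero.2 (hD x hx).2
    have a2 := (hy.2 x hx).1
    have a3 := sub_ne_zero.2 (hy.2 x hx).2.1
    simp only [l1]
    exact DifferentiableAt.differentiableWithinAt
      (DifferentiableAt.fun_div (by fun_prop) (by fun_prop) (by simp [*]))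
  have h2 : DifferentiableOn ℂ (fun x => l2 θ x (y x) (deriv y x)) D := by
    intro x hx
    have hn := hDo.mem_nhds hx
    have dy := hy.1.differentiableAt hn
    have dp := (hy.1.deriv hDo).differentiableAt hn
    have a0 := (hD x hx).1
    have a1 := sub_ne_zero.2 (hD x hx).2.symm
    have a2 := sub_ne_zero.2 (hy.2 x hx).2.1.symm
    have a3 := sub_ne_zero.2 (hy.2 x hx).2.2.1.symm
    simp only [l2]
    exact DifferentiableAt.differentiableWithinAt
      (DifferentiableAt.fun_mul (DifferentiableAt.fun_div (by fun_prop) (by fun_prop)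
        (by simp [*])) (by fun_prop))
  obtain ⟨L1, hL1⟩ := hex _ h1
  obtain ⟨L2, hL2⟩ := hex _ h2
  exact ⟨L1, L2, fun x hx => ⟨hL1 x hx, hL2 x hx⟩⟩

theorem SolvesQuadratures.givenByQuadratures {D : Set ℂ} {y k1 k2 : ℂ → ℂ} (hDo : IsOpen D)
    (hDc : IsPreconnected D) (hD : ∀ x ∈ D, x ≠ 0 ∧ x ≠ 1)
    (hex : ∀ f : ℂ → ℂ, DifferentiableOn ℂ f D → IsExactOn f D) (hy : IsTranscendent θ θinf D y)
    (hk : SolvesQuadratures θ D y k1 k2) : GivenByQuadratures θ D y k1 k2 := by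
  obtain ⟨L1, L2, hL⟩ := exists_primitives hDo hD hex hy
  obtain ⟨c1, h1, e1⟩ := exists_eq_const_mul hDo hDc (k := fun x => exp (L1 x))
    (fun x _ => exp_ne_zero _) (fun x hx => (hk x hx).1)
    (fun x hx => ((hL x hx).1.cexp).congr_deriv (mul_comm _ _)) fun x hx => (hk x hx).2.2.1
  obtain ⟨c2, h2, e2⟩ := exists_eq_const_mul hDo hDc (k := fun x => exp (L2 x))
    (fun x _ => exp_ne_zero _) (fun x hx => (hk x hx).2.1)
    (fun x hx => ((hL x hx).2.cexp).congr_deriv (mul_comm _ _)) fun x hx => (hk x hx).2.2.2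
  exact ⟨c1, c2, L1, L2, h1, h2, fun x hx => ⟨(hL x hx).1, (hL x hx).2, e1 x hx, e2 x hx⟩⟩

/-! ### The correspondence between transcendents and classes of solutions `Ω` -/

section Correspondence

variable {D : Set ℂ} {y y' : ℂ → ℂ} {Ω Ω' : ℂ → Mat3}

theorem OmegaFormulae.isOmegaSolution (hDo : IsOpen D) (hD : ∀ x ∈ D, x ≠ 0 ∧ x ≠ 1)
    (hinf : θinf ≠ 0) (hy : IsTranscendent θ θinf D y) (h : OmegaFormulae θ θinf D y Ω) :
    IsOmegaSolution θ θinf D Ω ∧ ∀ x ∈ D, Nondegenerate θ θinf ![0, x, 1] (Ω x) := by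
  obtain ⟨k1, k2, hk, hE⟩ := h
  exact isOmegaSolution_explicitOmega hDo hD hinf hy (hk.solvesQuadratures hDo) hE

theorem exists_omegaFormulae_of_transcendent (hDo : IsOpen D) (hD : ∀ x ∈ D, x ≠ 0 ∧ x ≠ 1)
    (hex : ∀ f : ℂ → ℂ, DifferentiableOn ℂ f D → IsExactOn f D)
    (hy : IsTranscendent θ θinf D y) : ∃ Ω : ℂ → Mat3, OmegaFormulae θ θinf D y Ω := by
  obtain ⟨L1, L2, hL⟩ := exists_primitives hDo hD hex hy
  exact ⟨fun x => explicitOmega θ θinf x (y x) (deriv y x) (exp (L1 x)) (exp (L2 x)),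
    fun x => exp (L1 x), fun x => exp (L2 x),
    ⟨1, 1, L1, L2, one_ne_zero, one_ne_zero, fun x hx =>
      ⟨(hL x hx).1, (hL x hx).2, (one_mul _).symm, (one_mul _).symm⟩⟩, fun x _ => rfl⟩

theorem exists_omegaFormulae_of_isOmegaSolution (hDo : IsOpen D) (hDc : IsPreconnected D)
    (hD : ∀ x ∈ D, x ≠ 0 ∧ x ≠ 1) (hex : ∀ f : ℂ → ℂ, DifferentiableOn ℂ f D → IsExactOn f D)
    (hinf : θinf ≠ 0) (hadd : θinf ≠ ∑ i, θ i) (hsub : θinf ≠ -∑ i, θ i)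
    (hΩ : IsOmegaSolution θ θinf D Ω) (hnd : ∀ x ∈ D, Nondegenerate θ θinf ![0, x, 1] (Ω x)) :
    ∃ y : ℂ → ℂ, IsTranscendent θ θinf D y ∧ OmegaFormulae θ θinf D y Ω := by
  obtain ⟨y, k1, k2, hy, hk, hE⟩ :=
    exists_transcendent_of_isOmegaSolution hDo hD hinf hadd hsub hΩ hnd
  exact ⟨y, hy, k1, k2, hk.givenByQuadratures hDo hDc hD hex hy, hE⟩

theorem OmegaFormulae.of_diagConj (h : OmegaFormulae θ θinf D y Ω) (hc : DiagConj D Ω Ω') :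
    OmegaFormulae θ θinf D y Ω' := by
  obtain ⟨k1, k2, ⟨a1, a2, L1, L2, h1, h2, hL⟩, hE⟩ := h
  obtain ⟨c1, c2, g1, g2, hc⟩ := hc
  refine ⟨fun x => c1 * k1 x, fun x => c2 * k2 x, ⟨c1 * a1, c2 * a2, L1, L2, mul_ne_zero g1 h1,
    mul_ne_zero g2 h2, fun x hx => ?_⟩, fun x hx => ?_⟩
  · obtain ⟨d1, d2, e1, e2⟩ := hL x hx
    exact ⟨d1, d2, by simp only [e1, mul_assoc], by simp only [e2, mul_assoc]⟩
  · rw [hc x hx, hE x hx, explicitOmega_mul _ _ _ _ _ _ _ g1 g2]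

/-- The transcendent and the class of the matrix determine each other: the transcendent is
determined by eigenvectors of the matrix, and the quadratures determine `k₁`, `k₂` up to constant
factors. -/
theorem eqOn_iff_diagConj (hDo : IsOpen D) (hDc : IsPreconnected D) (hD : ∀ x ∈ D, x ≠ 0 ∧ x ≠ 1)
    (hinf : θinf ≠ 0) (hadd : θinf ≠ ∑ i, θ i) (hsub : θinf ≠ -∑ i, θ i)
    (hy : IsTranscendent θ θinf D y) (hy' : IsTranscendent θ θinf D y')
    (h : OmegaFormulae θ θinf D y Ω) (h' : OmegaFormulae θ θinf D y' Ω') :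
    Set.EqOn y y' D ↔ DiagConj D Ω Ω' := by
  constructor
  · intro e
    obtain ⟨k1, k2, hk, hE⟩ := h
    obtain ⟨m1, m2, hm, hE'⟩ := h'
    have hk := hk.solvesQuadratures hDo
    have hm := hm.solvesQuadratures hDo
    have de : ∀ x ∈ D, deriv y x = deriv y' x := fun x hx =>
      (e.eventuallyEq_of_mem (hDo.mem_nhds hx)).deriv_eq
    obtain ⟨c1, g1, e1⟩ := exists_eq_const_mul hDo hDc (fun x hx => (hk x hx).1)
      (fun x hx => (hm x hx).1) (fun x hx => (hk x hx).2.2.1)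
      (fun x hx => by rw [e hx, de x hx]; exact (hm x hx).2.2.1)
    obtain ⟨c2, g2, e2⟩ := exists_eq_const_mul hDo hDc (fun x hx => (hk x hx).2.1)
      (fun x hx => (hm x hx).2.1) (fun x hx => (hk x hx).2.2.2)
      (fun x hx => by rw [e hx, de x hx]; exact (hm x hx).2.2.2)
    refine ⟨c1, c2, g1, g2, fun x hx => ?_⟩
    rw [hE' x hx, hE x hx, e1 x hx, e2 x hx, explicitOmega_mul _ _ _ _ _ _ _ g1 g2, e hx, de x hx]
  · intro hc x hx
    obtain ⟨k1, k2, hk, hE⟩ := h.of_diagConj hc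
    obtain ⟨m1, m2, hm, hE'⟩ := h'
    have ad := (hk.solvesQuadratures hDo).admissible hD hy hx
    have ad' := (hm.solvesQuadratures hDo).admissible hD hy' hx
    have hEE : explicitOmega θ θinf x (y' x) (deriv y' x) (m1 x) (m2 x)
        = explicitOmega θ θinf x (y x) (deriv y x) (k1 x) (k2 x) := by rw [← hE x hx, ← hE' x hx]
    have hl := ad'.vecMul_explicitOmega (θ := θ) (θinf := θinf) (p := deriv y' x)
    have hr := ad'.mulVec_explicitOmega (θ := θ) (θinf := θinf) (p := deriv y' x)
    have u' := (ad'.eq_of_eigenvectors hinf hadd hsub hl hr (ad'.explicitLeft_ne_zero 2)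
      (ad'.explicitRight_ne_zero 2)).2.2.2
    rw [hEE] at hl hr
    have u := (ad.eq_of_eigenvectors hinf hadd hsub hl hr (ad'.explicitLeft_ne_zero 2)
      (ad'.explicitRight_ne_zero 2)).2.2.2
    rw [u, ← u']

end Correspondence

/-- A relation that is total on both sides and compatible with the equivalence relations induces a
bijection of the quotients. -/
theorem exists_equiv_quotient {α β : Type*} (s : Setoid α) (t : Setoid β) (R : α → β → Prop)
    (hα : ∀ a, ∃ b, R a b) (hβ : ∀ b, ∃ a, R a b)
    (hR : ∀ a a' b b', R a b → R a' b' → (s a a' ↔ t b b'))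
    (ht : ∀ a b b', R a b → t b b' → R a b') :
    ∃ Φ : Quotient s ≃ Quotient t, ∀ a b, Φ (Quotient.mk s a) = Quotient.mk t b ↔ R a b := by
  choose f hf using hα
  choose g hg using hβ
  let F : Quotient s → Quotient t := Quotient.map f fun a a' h => (hR a a' _ _ (hf a) (hf a')).1 h
  let G : Quotient t → Quotient s := Quotient.map g fun b b' h => (hR _ _ b b' (hg b) (hg b')).2 h
  refine ⟨⟨F, G, ?_, ?_⟩, fun a b => ?_⟩
  · intro q
    induction q using Quotient.inductionOn with
    | h a => exact Quotient.sound ((hR _ _ _ _ (hg (f a)) (hf a)).2 (t.refl _))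
  · intro q
    induction q using Quotient.inductionOn with
    | h b => exact Quotient.sound ((hR _ _ _ _ (hf (g b)) (hg b)).1 (s.refl _))
  · change Quotient.mk t (f a) = Quotient.mk t b ↔ R a b
    constructor
    · intro h
      exact ht a _ b (hf a) (Quotient.exact h)
    · intro h
      exact Quotient.sound ((hR a a _ _ (hf a) h).1 (s.refl a))

theorem exists_equiv_omega {D : Set ℂ} (hDo : IsOpen D) (hDc : IsPreconnected D)
    (hD : ∀ x ∈ D, x ≠ 0 ∧ x ≠ 1) (hex : ∀ f : ℂ → ℂ, DifferentiableOn ℂ f D → IsExactOn f D)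
    (hinf : θinf ≠ 0) (hadd : θinf ≠ ∑ i, θ i) (hsub : θinf ≠ -∑ i, θ i) :
    ∃ Φ : Quotient (transcendentSetoid θ θinf D) ≃ Quotient (omegaSetoid θ θinf D),
      ∀ y Ω, Φ (Quotient.mk _ y) = Quotient.mk _ Ω ↔ OmegaFormulae θ θinf D y.1 Ω.1 := by
  refine exists_equiv_quotient (transcendentSetoid θ θinf D) (omegaSetoid θ θinf D)
    (fun y Ω => OmegaFormulae θ θinf D y.1 Ω.1) ?_ ?_ ?_ ?_
  · rintro ⟨y, hy⟩
    obtain ⟨Ω, hΩ⟩ := exists_omegaFormulae_of_transcendent hDo hD hex hy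
    exact ⟨⟨Ω, hΩ.isOmegaSolution hDo hD hinf hy⟩, hΩ⟩
  · rintro ⟨Ω, hΩ, hnd⟩
    obtain ⟨y, hy, h⟩ :=
      exists_omegaFormulae_of_isOmegaSolution hDo hDc hD hex hinf hadd hsub hΩ hnd
    exact ⟨⟨y, hy⟩, h⟩
  · rintro ⟨y, hy⟩ ⟨y', hy'⟩ ⟨Ω, hΩ⟩ ⟨Ω', hΩ'⟩ h h'
    exact eqOn_iff_diagConj hDo hDc hD hinf hadd hsub hy hy' h h'
  · rintro ⟨y, hy⟩ ⟨Ω, hΩ⟩ ⟨Ω', hΩ'⟩ h hc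
    exact OmegaFormulae.of_diagConj h hc

/-! ### The correspondence between transcendents and classes of solutions `V` -/

section Convex

variable {𝔻 : Set (Fin 3 → ℂ)} {L : (Fin 3 → ℂ) → ℂ}

theorem isPreconnected_fibre (hc : Convex ℝ 𝔻) (hd : Disjoint 𝔻 coalescenceLocus) (c : ℂ) :
    IsPreconnected {u | u ∈ 𝔻 ∧ xOf u = c} := by
  have h : {u | u ∈ 𝔻 ∧ xOf u = c} = 𝔻 ∩ {u | u 1 - u 0 = c * (u 2 - u 0)} := by
    ext u
    refine and_congr_right fun hu => ?_
    exact div_eq_iff (ne_of_disjoint hd hu (by decide))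
  rw [h]
  refine (hc.inter ?_).isPreconnected
  intro u hu v hv a b _ _ _
  simp only [Set.mem_ofPred_eq, Pi.add_apply, Pi.smul_apply, real_smul] at hu hv ⊢
  linear_combination (a : ℂ) * hu + b * hv

theorem isPreconnected_image_xOf (hc : Convex ℝ 𝔻) (hd : Disjoint 𝔻 coalescenceLocus) :
    IsPreconnected (xOf '' 𝔻) :=
  hc.isPreconnected.image xOf fun _ hu =>
    (hasFDerivAt_xOf (ne_of_disjoint hd hu (by decide))).continuousAt.continuousWithinAt

/-- Holomorphic functions on the image of a convex set under `x` have primitives: the pullback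
`f(x) dx` is closed, hence exact on the convex set, and a primitive of it is a function of `x`. -/
theorem isExactOn_image_xOf (ho : IsOpen 𝔻) (hc : Convex ℝ 𝔻) (hd : Disjoint 𝔻 coalescenceLocus)
    (f : ℂ → ℂ) (hf : DifferentiableOn ℂ f (xOf '' 𝔻)) : IsExactOn f (xOf '' 𝔻) := by
  let A : (Fin 3 → ℂ) →L[ℂ] ℂ := ContinuousLinearMap.proj (R := ℂ) (φ := fun _ => ℂ) 1
      - ContinuousLinearMap.proj (R := ℂ) (φ := fun _ => ℂ) 0
  let B : (Fin 3 → ℂ) →L[ℂ] ℂ := ContinuousLinearMap.proj (R := ℂ) (φ := fun _ => ℂ) 2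
      - ContinuousLinearMap.proj (R := ℂ) (φ := fun _ => ℂ) 0
  have hA : ∀ u, A u = u 1 - u 0 := fun u => rfl
  have hB : ∀ u, B u = u 2 - u 0 := fun u => rfl
  have hder : ∀ u ∈ 𝔻, ∃ ω' : (Fin 3 → ℂ) →L[ℝ] (Fin 3 → ℂ) →L[ℂ] ℂ,
      HasFDerivAt (fun w => f (xOf w) • xOfDeriv w) ω' u ∧ ∀ v w, ω' v w = ω' w v := by
    intro u hu
    have h20 : B u ≠ 0 := ne_of_disjoint hd hu (by decide)
    have h1 := ((hf.differentiableAt ((isOpen_image_xOf ho hd).mem_nhds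
      ⟨u, hu, rfl⟩)).hasDerivAt.comp_hasFDerivAt u (hasFDerivAt_xOf h20))
    have h2 : HasFDerivAt (fun w => (B w)⁻¹) _ u :=
      (hasDerivAt_inv h20).comp_hasFDerivAt u B.hasFDerivAt
    have h3 := ((h1.mul h2).smul_const A).sub
      (((h1.mul A.hasFDerivAt).mul (h2.mul h2)).smul_const B)
    refine ⟨_, (h3.restrictScalars ℝ).congr_of_eventuallyEq (Filter.Eventually.of_forall ?_), ?_⟩
    · intro w
      ext v
      simp [xOfDeriv_apply, hA, hB]
      generalize w 2 - w 0 = s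
      ring
    · intro v w
      simp [xOfDeriv_apply, ← hA, ← hB]
      ring
  obtain ⟨F, hF⟩ := hc.exists_forall_hasFDerivAt_of_fderiv_symmetric ho
    (ω := fun u => f (xOf u) • xOfDeriv u)
    (fun u hu => (hder u hu).choose_spec.1.differentiableAt.differentiableWithinAt)
    (fun u hu v w => by
      rw [(hder u hu).choose_spec.1.fderiv]
      exact (hder u hu).choose_spec.2 v w)
  obtain ⟨G, hG⟩ := exists_hasDerivAt_of_hasFDerivAt ho hd (isPreconnected_fibre hc hd)
    (g := fun u => f (xOf u)) hF
  refine ⟨G, ?_⟩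
  rintro _ ⟨u, hu, rfl⟩
  exact (hG u hu).2

theorem diagConj_powConj_iff {V V' : (Fin 3 → ℂ) → Mat3} {Ω Ω' : ℂ → Mat3}
    (hV : ∀ u ∈ 𝔻, V u = powConj θ (L u) (Ω (xOf u)))
    (hV' : ∀ u ∈ 𝔻, V' u = powConj θ (L u) (Ω' (xOf u))) :
    DiagConj (xOf '' 𝔻) Ω Ω' ↔ DiagConj 𝔻 V V' := by
  constructor
  · rintro ⟨c1, c2, g1, g2, h⟩
    refine ⟨c1, c2, g1, g2, fun u hu => ?_⟩
    rw [hV u hu, hV' u hu, h _ ⟨u, hu, rfl⟩, powConj_diagonal_conj]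
  · rintro ⟨c1, c2, g1, g2, h⟩
    refine ⟨c1, c2, g1, g2, ?_⟩
    rintro _ ⟨u, hu, rfl⟩
    have := h u hu
    rw [hV u hu, hV' u hu, ← powConj_diagonal_conj] at this
    rw [← powConj_neg_powConj (θ := θ) (L u) (Ω' (xOf u)), this, powConj_neg_powConj]

theorem exists_equiv_V (ho : IsOpen 𝔻) (hc : Convex ℝ 𝔻) (hd : Disjoint 𝔻 coalescenceLocus)
    (hL : IsLogBranch 𝔻 L) (hinf : θinf ≠ 0) (hadd : θinf ≠ ∑ i, θ i) (hsub : θinf ≠ -∑ i, θ i) :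
    ∃ Φ : Quotient (transcendentSetoid θ θinf (xOf '' 𝔻)) ≃ Quotient (vSetoid θ θinf 𝔻),
      ∀ y V, Φ (Quotient.mk _ y) = Quotient.mk _ V ↔ VFormulae θ θinf 𝔻 L y.1 V.1 := by
  have hDo := isOpen_image_xOf ho hd
  have hDc := isPreconnected_image_xOf hc hd
  have hD := image_xOf_ne hd
  have hex := isExactOn_image_xOf ho hc hd
  refine exists_equiv_quotient (transcendentSetoid θ θinf (xOf '' 𝔻)) (vSetoid θ θinf 𝔻)
    (fun y V => VFormulae θ θinf 𝔻 L y.1 V.1) ?_ ?_ ?_ ?_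
  · rintro ⟨y, hy⟩
    obtain ⟨Ω, hΩ⟩ := exists_omegaFormulae_of_transcendent hDo hD hex hy
    obtain ⟨hs, hnd⟩ := hΩ.isOmegaSolution hDo hD hinf hy
    exact ⟨⟨fun u => powConj θ (L u) (Ω (xOf u)), isVSolution_powConj ho hd hL hs fun u _ => rfl,
      (nondegenerate_powConj_iff hinf hd fun u _ => rfl).2 hnd⟩, Ω, hΩ, fun u _ => rfl⟩
  · rintro ⟨V, hV, hnd⟩
    obtain ⟨Ω, hΩ, e⟩ := exists_isOmegaSolution ho hd (isPreconnected_fibre hc hd) hL hV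
    obtain ⟨y, hy, h⟩ := exists_omegaFormulae_of_isOmegaSolution hDo hDc hD hex hinf hadd hsub hΩ
      ((nondegenerate_powConj_iff hinf hd e).1 hnd)
    exact ⟨⟨y, hy⟩, Ω, h, e⟩
  · rintro ⟨y, hy⟩ ⟨y', hy'⟩ ⟨V, hV⟩ ⟨V', hV'⟩ ⟨Ω, h, e⟩ ⟨Ω', h', e'⟩
    exact (eqOn_iff_diagConj hDo hDc hD hinf hadd hsub hy hy' h h').trans
      (diagConj_powConj_iff e e')
  · rintro ⟨y, hy⟩ ⟨V, hV⟩ ⟨V', hV'⟩ ⟨Ω, h, e⟩ ⟨c1, c2, g1, g2, hc'⟩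
    refine ⟨fun x => Matrix.diagonal ![c1, c2, 1] * Ω x * Matrix.diagonal ![c1⁻¹, c2⁻¹, 1],
      h.of_diagConj ⟨c1, c2, g1, g2, fun x _ => rfl⟩, fun u hu => ?_⟩
    rw [hc' u hu, e u hu, powConj_diagonal_conj]

end Convex

end PainleveSix

theorem mainTheorem1 (θ : Fin 3 → ℂ) (θinf : ℂ) (hinf : θinf ≠ 0)
    (hadd : θinf ≠ ∑ i, θ i) (hsub : θinf ≠ -∑ i, θ i) :
    -- integrability of the Pfaffian system is the system of deformation equations
    (∀ (𝔻 : Set (Fin 3 → ℂ)) (V : (Fin 3 → ℂ) → Mat3),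
      IsOpen 𝔻 → Disjoint 𝔻 coalescenceLocus → HolomorphicOn 𝔻 V →
      (FrobeniusIntegrable (pfaffianForm V) {p | p 0 ≠ 0 ∧ Fin.tail p ∈ 𝔻} ↔
        DeformationEq 𝔻 V)) ∧
    -- the deformation equations are equivalent to the reduced system and to PVI
    (∀ (𝔻 : Set (Fin 3 → ℂ)) (L : (Fin 3 → ℂ) → ℂ),
      IsOpen 𝔻 → Disjoint 𝔻 coalescenceLocus →
      (∀ c : ℂ, IsPreconnected {u | u ∈ 𝔻 ∧ xOf u = c}) → IsLogBranch 𝔻 L →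
      ∀ V : (Fin 3 → ℂ) → Mat3,
        (IsVSolution θ θinf 𝔻 V ↔
          ∃ Ω : ℂ → Mat3, IsOmegaSolution θ θinf (xOf '' 𝔻) Ω ∧
            ∀ u ∈ 𝔻, V u = powConj θ (L u) (Ω (xOf u))) ∧
        ((IsVSolution θ θinf 𝔻 V ∧ ∀ u ∈ 𝔻, Nondegenerate θ θinf u (V u)) ↔
          ∃ y k1 k2 : ℂ → ℂ, IsTranscendent θ θinf (xOf '' 𝔻) y ∧
            SolvesQuadratures θ (xOf '' 𝔻) y k1 k2 ∧
            ∀ u ∈ 𝔻, V u = powConj θ (L u)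
              (explicitOmega θ θinf (xOf u) (y (xOf u)) (deriv y (xOf u))
                (k1 (xOf u)) (k2 (xOf u))))) ∧
    -- the reduced system is equivalent to PVI
    (∀ D : Set ℂ, IsOpen D → (∀ x ∈ D, x ≠ 0 ∧ x ≠ 1) → ∀ Ω : ℂ → Mat3,
      ((IsOmegaSolution θ θinf D Ω ∧ ∀ x ∈ D, Nondegenerate θ θinf ![0, x, 1] (Ω x)) ↔
        ∃ y k1 k2 : ℂ → ℂ, IsTranscendent θ θinf D y ∧ SolvesQuadratures θ D y k1 k2 ∧
          ∀ x ∈ D, Ω x = explicitOmega θ θinf x (y x) (deriv y x) (k1 x) (k2 x))) ∧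
    -- a solution that is nondegenerate somewhere is so off a discrete set
    (∀ D : Set ℂ, IsOpen D → IsPreconnected D → (∀ x ∈ D, x ≠ 0 ∧ x ≠ 1) → ∀ Ω : ℂ → Mat3,
      IsOmegaSolution θ θinf D Ω → (∃ x ∈ D, Nondegenerate θ θinf ![0, x, 1] (Ω x)) →
      ∃ D' : Set ℂ, D' = {x | x ∈ D ∧ Nondegenerate θ θinf ![0, x, 1] (Ω x)} ∧
        IsOpen D' ∧ D' ∈ Filter.codiscreteWithin D ∧
        ∃ y k1 k2 : ℂ → ℂ, MeromorphicOn y D ∧ IsTranscendent θ θinf D' y ∧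
          SolvesQuadratures θ D' y k1 k2 ∧
          ∀ x ∈ D', Ω x = explicitOmega θ θinf x (y x) (deriv y x) (k1 x) (k2 x)) ∧
    -- one-to-one correspondence between transcendents and classes of solutions `Ω`
    (∀ D : Set ℂ, IsOpen D → IsPreconnected D → (∀ x ∈ D, x ≠ 0 ∧ x ≠ 1) →
      (∀ f : ℂ → ℂ, DifferentiableOn ℂ f D → Complex.IsExactOn f D) →
      ∃ Φ : Quotient (transcendentSetoid θ θinf D) ≃ Quotient (omegaSetoid θ θinf D),
        ∀ y Ω, Φ (Quotient.mk _ y) = Quotient.mk _ Ω ↔ OmegaFormulae θ θinf D y.1 Ω.1) ∧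
    -- one-to-one correspondence between transcendents and classes of solutions `V`
    (∀ (𝔻 : Set (Fin 3 → ℂ)) (L : (Fin 3 → ℂ) → ℂ),
      IsOpen 𝔻 → Convex ℝ 𝔻 → Disjoint 𝔻 coalescenceLocus → IsLogBranch 𝔻 L →
      ∃ Φ : Quotient (transcendentSetoid θ θinf (xOf '' 𝔻)) ≃ Quotient (vSetoid θ θinf 𝔻),
        ∀ y V, Φ (Quotient.mk _ y) = Quotient.mk _ V ↔ VFormulae θ θinf 𝔻 L y.1 V.1) := by
  refine ⟨?_, ?_, ?_, ?_, ?_, ?_⟩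
  · intro 𝔻 V ho hd hV
    exact frobeniusIntegrable_iff hV ho hd
  · intro 𝔻 L ho hd hfib hL V
    have hDo := isOpen_image_xOf ho hd
    have hD := image_xOf_ne hd
    refine ⟨⟨exists_isOmegaSolution ho hd hfib hL, ?_⟩, ?_, ?_⟩
    · rintro ⟨Ω, hΩ, e⟩
      exact isVSolution_powConj ho hd hL hΩ e
    · rintro ⟨hV, hnd⟩
      obtain ⟨Ω, hΩ, e⟩ := exists_isOmegaSolution ho hd hfib hL hV
      obtain ⟨y, k1, k2, hy, hk, hE⟩ := exists_transcendent_of_isOmegaSolution hDo hD hinf hadd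
        hsub hΩ ((nondegenerate_powConj_iff hinf hd e).1 hnd)
      exact ⟨y, k1, k2, hy, hk, fun u hu => by rw [e u hu, hE _ ⟨u, hu, rfl⟩]⟩
    · rintro ⟨y, k1, k2, hy, hk, e⟩
      obtain ⟨Ω, hE⟩ : ∃ Ω : ℂ → Mat3, ∀ x,
          Ω x = explicitOmega θ θinf x (y x) (deriv y x) (k1 x) (k2 x) := ⟨_, fun _ => rfl⟩
      obtain ⟨hΩ, hnd⟩ := isOmegaSolution_explicitOmega hDo hD hinf hy hk fun x _ => hE x
      have e' : ∀ u ∈ 𝔻, V u = powConj θ (L u) (Ω (xOf u)) := fun u hu => by rw [hE, e u hu]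
      exact ⟨isVSolution_powConj ho hd hL hΩ e', (nondegenerate_powConj_iff hinf hd e').2 hnd⟩
  · intro D hDo hD Ω
    constructor
    · rintro ⟨hΩ, hnd⟩
      exact exists_transcendent_of_isOmegaSolution hDo hD hinf hadd hsub hΩ hnd
    · rintro ⟨y, k1, k2, hy, hk, hE⟩
      exact isOmegaSolution_explicitOmega hDo hD hinf hy hk hE
  · intro D hDo hDc hD Ω hΩ hex
    exact exists_meromorphic_transcendent hDo hDc hD hinf hadd hsub hΩ hex
  · intro D hDo hDc hD hex
    exact exists_equiv_omega hDo hDc hD hex hinf hadd hsub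
  · intro 𝔻 L ho hc hd hL
    exact exists_equiv_V ho hc hd hL hinf hadd hsub
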